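/- **Theorem 4.1 (Quasi-stability).** Let $H$ be a (real or complex) separable Hilbert space with norm $\|\cdot\|$, and let $A$ be a positive self-adjoint operator in $H$ with discrete spectrum: there is an orthonormal basis $(e_n)_{n\ge1}$ of $H$ with $Ae_n=\mu_ne_n$, $0<\mu_1\le\mu_2\le\dots$, $\mu_n\to\infty$. The space $D(A^{1/2})$ carries the norm $\|A^{1/2}\cdot\|$. Let $h>0$ and $W=C([-h,0];D(A^{1/2}))\cap C^1([-h,0];H)$ with the norm $|\varphi|_W=\max_{\theta\in[-h,0]}\|A^{1/2}\varphi(\theta)\|+\max_{\theta\in[-h,0]}\|\dot\varphi(\theta)\|$. Consider, with a damping parameter $k>0$, $$\ddot u(t)+k\dot u(t)+Au(t)+F(u(t))+M(u_t)=0,\quad t>0,\qquad u_0=\varphi\in W,\qquad u_t(\theta)=u(t+\theta),\ \theta\in[-h,0].$$ A mild solution on $[0,\infty)$ is a function $u\in C([-h,\infty);D(A^{1/2}))\cap C^1([-h,\infty);H)$ with $u=\varphi$ on $[-h,0]$ such that $U=(u,\dot u)$ satisfies, for all $t\ge0$, $$U(t)=e^{-t\mathcal A}U(0)+\int_0^te^{-(t-s)\mathcal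 A}\bigl(0,\,-F(u(s))-M(u_s)\bigr)\,ds,$$ where $e^{-t\mathcal A}$ is the $C_0$-semigroup on $D(A^{1/2})\times H$ generated by $-\mathcal A$, $\mathcal A(u,v)=(-v,Au+kv)$, $D(\mathcal A)=D(A)\times D(A^{1/2})$. Assume: * (F1) $F:D(A^{1/2})\to H$ is locally Lipschitz: for every $R>0$ there is $L>0$ with $\|F(u^1)-F(u^2)\|\le L\|A^{1/2}(u^1-u^2)\|$ whenever $\|A^{1/2}u^i\|\le R$. * (F2) $F=\Pi'+F^*$, where $\Pi'$ is the (real) Fréchet derivative of a $C^1$ functional $\Pi:D(A^{1/2})\to\mathbb R$ (the functional $\Pi'(u)$ being represented by an element of $H$ through $v\mapsto\operatorname{Re}(\Pi'(u),v)$), $F^*:D(A^{1/2})\to H$ satisfies $\|F^*(u^1)-F^*(u^2)\|^2\le c_0\|A^{1/2}(u^1-u^2)\|^2$, and $\Pi=\Pi_0+\Pi_1$ with $\Pi_0\ge0$ bounded on bounded sets and such that for every $\varepsilon>0$ there is $C_\varepsilon>0$ with $|\Pi_1(u)|\le\varepsilon(\|A^{1/2}u\|^2+\Pi_0(u))+C_\varepsilon$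 for all $u\in D(A^{1/2})$. * (M1) $M:W\to H$ is locally Lipschitz: for every $\varrho>0$ there is $C_\varrho$ with $\|M(\varphi^1)-M(\varphi^2)\|\le C_\varrho|\varphi^1-\varphi^2|_W$ whenever $|\varphi^i|_W\le\varrho$. * (M2) $\|M(\varphi)\|\le M_0+M_1|\varphi|_W$ for all $\varphi\in W$, with some $M_0,M_1\ge0$. * (M4) There is $\delta_M>0$ such that for every $\varrho>0$ there is $L(\varrho)>0$ with $\|M(\varphi^1)-M(\varphi^2)\|\le L(\varrho)\max_{\theta\in[-h,0]}\|A^{1/2-\delta_M}(\varphi^1(\theta)-\varphi^2(\theta))\|$ whenever $|\varphi^i|_W\le\varrho$. For $\eta\ge0$ consider the condition $$\forall R>0\ \exists L_F(R)>0:\quad\|F(u^1)-F(u^2)\|\le L_F(R)\|A^{1/2-\eta}(u^1-u^2)\|\quad\text{whenever }\|A^{1/2}u^i\|\le R.\tag{$*_\eta$}$$ Call $F$ *subcritical* if $(*_\eta)$ holds for some $\eta>0$, and *critical* if $(*_0)$ holds. Given $k$, $R$, $\delta$, $\tilde\lambda$, $C_1$, $C_2$, say that (QS) holds if for any two mild solutions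 $u^1,u^2$ with initial data $\varphi^1,\varphi^2\in W$ and $$\|\dot u^i(t)\|^2+\|A^{1/2}u^i(t)\|^2\le R^2\quad\text{for all }t\ge-h,\ i=1,2,$$ one has, for all $t\ge0$, $$\|\dot u^1(t)-\dot u^2(t)\|^2+\|A^{1/2}(u^1(t)-u^2(t))\|^2\le C_1e^{-\tilde\lambda t}|\varphi^1-\varphi^2|_W^2+C_2\max_{\xi\in[0,t]}\|A^{1/2-\delta}(u^1(\xi)-u^2(\xi))\|^2.$$ Then: 1. (Subcritical case.) If $F$ is subcritical, there is $\delta>0$ such that for every $k>0$ there is $\tilde\lambda>0$ such that for every $R>0$ there are $C_1,C_2>0$ for which (QS) holds. 2. (Critical case, large damping.) If $F$ is critical, there are $\delta>0$ and $\tilde\lambda>0$ such that for every $R>0$ there is $k_0>0$ such that for every $k\ge k_0$ there are $C_1,C_2>0$ for which (QS) holds. -/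

import Mathlib

open Set Filter Topology
open scoped NNReal

noncomputable section

namespace DelayWave

variable {𝕜 H : Type*} [RCLike 𝕜] [NormedAddCommGroup H] [InnerProductSpace 𝕜 H] [CompleteSpace H]

/-- A positive (self-adjoint, densely defined) operator `A` with discrete spectrum in the Hilbert
space `H`, together with an orthonormal basis `e` of eigenvectors, `A eₙ = μₙ eₙ`, with
`0 < μ₀ ≤ μ₁ ≤ …` and `μₙ → ∞`. -/
structure PositiveDiscrete (A : H →ₗ.[𝕜] H) where
  isSelfAdjoint : IsSelfAdjoint A
  e : HilbertBasis ℕ 𝕜 H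
  μ : ℕ → ℝ
  mem_domain : ∀ n, e n ∈ A.domain
  apply_e : ∀ n, A ⟨e n, mem_domain n⟩ = (μ n : 𝕜) • e n
  μ_pos : 0 < μ 0
  μ_mono : Monotone μ
  μ_tendsto : Tendsto μ atTop atTop

namespace PositiveDiscrete

variable {A : H →ₗ.[𝕜] H} (hA : PositiveDiscrete A)

lemma pos (n : ℕ) : 0 < hA.μ n := hA.μ_pos.trans_le (hA.μ_mono (Nat.zero_le n))

/-- The coefficients `μₙ^α (x, eₙ)` of `A^α x`. -/
def powCoeff (α : ℝ) (x : H) (n : ℕ) : 𝕜 := ((hA.μ n ^ α : ℝ) : 𝕜) * hA.e.repr x n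

/-- The fractional power `A^α` with its domain
`D(A^α) = {x | ∑ₙ μₙ^(2α) |(x, eₙ)|² < ∞}`, on which `A^α x = ∑ₙ μₙ^α (x, eₙ) eₙ`. -/
def pow (α : ℝ) : H →ₗ.[𝕜] H where
  domain :=
    { carrier := {x | Memℓp (hA.powCoeff α x) 2}
      add_mem' := by
        intro x y hx hy
        have h : hA.powCoeff α (x + y) = hA.powCoeff α x + hA.powCoeff α y := by
          ext n
          simp [powCoeff, mul_add]
        simpa [h] using Memℓp.add hx hy
      zero_mem' := by
        have h : hA.powCoeff α 0 = 0 := by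
          ext n
          simp [powCoeff]
        simpa [h] using (zero_memℓp : Memℓp (0 : ℕ → 𝕜) 2)
      smul_mem' := by
        intro c x hx
        have h : hA.powCoeff α (c • x) = c • hA.powCoeff α x := by
          ext n
          simp [powCoeff, mul_left_comm]
        simpa [h] using Memℓp.const_smul hx c }
  toFun :=
    { toFun := fun x => hA.e.repr.symm ⟨hA.powCoeff α x.1, x.2⟩
      map_add' := by
        intro x y
        rw [← map_add]
        congr 1
        ext n
        show hA.powCoeff α (x.1 + y.1) n = hA.powCoeff α x.1 n + hA.powCoeff α y.1 n
        simp [powCoeff, mul_add]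
      map_smul' := by
        intro c x
        rw [RingHom.id_apply, ← map_smul]
        congr 1
        ext n
        show hA.powCoeff α (c • x.1) n = c * hA.powCoeff α x.1 n
        simp [powCoeff, mul_left_comm] }

lemma pow_injective (α : ℝ) : Function.Injective (hA.pow α).toFun := by
  rw [← LinearMap.ker_eq_bot, LinearMap.ker_eq_bot']
  intro x hx
  have h0 : hA.powCoeff α x.1 = 0 := by
    have h1 : (⟨hA.powCoeff α x.1, x.2⟩ : lp (fun _ : ℕ => 𝕜) 2) = 0 :=
      hA.e.repr.symm.injective (by rw [map_zero]; exact hx)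
    exact congrArg Subtype.val h1
  have h2 : hA.e.repr x.1 = 0 := by
    ext n
    have h3 := congrFun h0 n
    have h4 : ((hA.μ n ^ α : ℝ) : 𝕜) ≠ 0 := by
      exact_mod_cast (Real.rpow_pos_of_pos (hA.pos n) α).ne'
    simpa [powCoeff, h4] using h3
  have h5 : x.1 = 0 := hA.e.repr.injective (by rw [h2, map_zero])
  exact Subtype.ext h5

/-- `D(A^β) ⊆ D(A^α)` for `α ≤ β`. -/
lemma pow_domain_anti {α β : ℝ} (hαβ : α ≤ β) : (hA.pow β).domain ≤ (hA.pow α).domain := by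
  intro x hx
  have hx' : Memℓp (hA.powCoeff β x) 2 := hx
  show Memℓp (hA.powCoeff α x) 2
  have hkey : ∀ n, ‖hA.powCoeff α x n‖ ≤ hA.μ 0 ^ (α - β) * ‖hA.powCoeff β x n‖ := by
    intro n
    have hn := hA.pos n
    have h1 : hA.μ n ^ α ≤ hA.μ 0 ^ (α - β) * hA.μ n ^ β := by
      have h2 : hA.μ n ^ α = hA.μ n ^ (α - β) * hA.μ n ^ β := by
        rw [← Real.rpow_add hn]; congr 1; ring
      rw [h2]
      exact mul_le_mul_of_nonneg_right
        (Real.rpow_le_rpow_of_nonpos hA.μ_pos (hA.μ_mono (Nat.zero_le n)) (by linarith))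
        (Real.rpow_nonneg hn.le β)
    simp only [powCoeff, norm_mul, RCLike.norm_ofReal, abs_of_nonneg (Real.rpow_nonneg hn.le α),
      abs_of_nonneg (Real.rpow_nonneg hn.le β)]
    rw [← mul_assoc]
    exact mul_le_mul_of_nonneg_right h1 (norm_nonneg _)
  have h2 : 0 < (2 : ENNReal).toReal := by norm_num
  rw [memℓp_gen_iff h2] at hx' ⊢
  refine Summable.of_nonneg_of_le (fun n => by positivity) (fun n => ?_)
    (hx'.mul_left ((hA.μ 0 ^ (α - β)) ^ (2 : ENNReal).toReal))
  rw [← Real.mul_rpow (Real.rpow_nonneg hA.μ_pos.le _) (norm_nonneg _)]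
  exact Real.rpow_le_rpow (norm_nonneg _) (hkey n) h2.le

/-- The energy space `D(A^{1/2})`; its norm, defined below, is `‖A^{1/2} u‖`. -/
def Energy : Type _ := (hA.pow (1 / 2)).domain

instance : AddCommGroup hA.Energy := inferInstanceAs (AddCommGroup (hA.pow (1 / 2)).domain)
instance : Module 𝕜 hA.Energy := inferInstanceAs (Module 𝕜 (hA.pow (1 / 2)).domain)

/-- The inclusion `D(A^{1/2}) ⊆ H`. -/
def incl : hA.Energy →ₗ[𝕜] H := (hA.pow (1 / 2)).domain.subtype

/-- `A^{1/2}` as a linear map on `D(A^{1/2})`. -/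
def sqrtOp : hA.Energy →ₗ[𝕜] H := (hA.pow (1 / 2)).toFun

instance : NormedAddCommGroup hA.Energy :=
  NormedAddCommGroup.induced hA.Energy H hA.sqrtOp (hA.pow_injective (1 / 2))

lemma norm_def (u : hA.Energy) : ‖u‖ = ‖hA.sqrtOp u‖ := rfl

instance : NormedSpace 𝕜 hA.Energy := NormedSpace.induced 𝕜 hA.Energy H hA.sqrtOp

instance [NormedSpace ℝ H] [IsScalarTower ℝ 𝕜 H] : Module ℝ hA.Energy :=
  inferInstanceAs (Module ℝ (hA.pow (1 / 2)).domain)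

instance [NormedSpace ℝ H] [IsScalarTower ℝ 𝕜 H] : IsScalarTower ℝ 𝕜 hA.Energy :=
  inferInstanceAs (IsScalarTower ℝ 𝕜 (hA.pow (1 / 2)).domain)

instance [NormedSpace ℝ H] [IsScalarTower ℝ 𝕜 H] : NormedSpace ℝ hA.Energy :=
  NormedSpace.induced ℝ hA.Energy H (hA.sqrtOp.restrictScalars ℝ)

/-- `A^{1/2 - δ} u` for `u ∈ D(A^{1/2})` and `δ ≥ 0`. -/
def lowPow (δ : ℝ≥0) (u : hA.Energy) : H :=
  hA.pow (1 / 2 - δ) ⟨hA.incl u, hA.pow_domain_anti (by simp) u.2⟩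

/-- The exponential `exp (-t 𝒜ₘ)` of the matrix `𝒜ₘ = (0, -1; m, k)`, through which the operator
`𝒜 (u, v) = (-v, A u + k v)` acts on the plane of the pairs `(a eₙ, b eₙ)` when `μₙ = m`. -/
def modeExp (k t m : ℝ) : Matrix (Fin 2) (Fin 2) ℝ :=
  NormedSpace.exp ((-t) • (!![0, -1; m, k] : Matrix (Fin 2) (Fin 2) ℝ))

/-- The `C₀`-semigroup `e^{-t𝒜}` on `Y = D(A^{1/2}) × H`, where `𝒜 (u, v) = (-v, A u + k v)` on
`D(𝒜) = D(A) × D(A^{1/2})`, written in the orthonormal basis `e`. For `t ≥ 0` and `(u, v) ∈ Y` both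
series converge (the first one in `D(A^{1/2})`, a fortiori in `H`). -/
def semigroup (k t : ℝ) (U : H × H) : H × H :=
  (∑' n, (((modeExp k t (hA.μ n) 0 0 : ℝ) : 𝕜) * inner 𝕜 (hA.e n) U.1 +
      ((modeExp k t (hA.μ n) 0 1 : ℝ) : 𝕜) * inner 𝕜 (hA.e n) U.2) • hA.e n,
   ∑' n, (((modeExp k t (hA.μ n) 1 0 : ℝ) : 𝕜) * inner 𝕜 (hA.e n) U.1 +
      ((modeExp k t (hA.μ n) 1 1 : ℝ) : 𝕜) * inner 𝕜 (hA.e n) U.2) • hA.e n)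

variable [NormedSpace ℝ H] [IsScalarTower ℝ 𝕜 H]

/-- The phase space `W = C([-h,0]; D(A^{1/2})) ∩ C¹([-h,0]; H)`. An element is recorded as the pair
`(φ, φ')` of a continuous `D(A^{1/2})`-valued function and its continuous `H`-valued derivative
(one-sided at the endpoints), which `φ` determines when `h > 0`. -/
def phaseSpace (h : ℝ) : Submodule ℝ (C(Icc (-h) 0, hA.Energy) × C(Icc (-h) 0, H)) where
  carrier := {φ | ∀ θ : Icc (-h) 0, ∃ g : ℝ → H, (∀ s : Icc (-h) 0, g s = hA.incl (φ.1 s)) ∧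
    HasDerivWithinAt g (φ.2 θ) (Icc (-h) 0) θ}
  add_mem' := by
    intro φ ψ hφ hψ θ
    obtain ⟨f, hf, hf'⟩ := hφ θ
    obtain ⟨g, hg, hg'⟩ := hψ θ
    exact ⟨f + g, fun s => by simp [hf, hg], hf'.add hg'⟩
  zero_mem' := fun θ => ⟨0, fun s => by simp, hasDerivWithinAt_const _ _ _⟩
  smul_mem' := by
    intro c φ hφ θ
    obtain ⟨f, hf, hf'⟩ := hφ θ
    refine ⟨c • f, fun s => ?_, hf'.const_smul c⟩
    simp [hf]

/-- The norm `|φ|_W = max ‖A^{1/2} φ(θ)‖ + max ‖φ'(θ)‖`, the maxima over `θ ∈ [-h,0]`. -/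
def wNorm {h : ℝ} (φ : hA.phaseSpace h) : ℝ := ‖φ.1.1‖ + ‖φ.1.2‖

/-- The functions of the class `C([-h,∞); D(A^{1/2})) ∩ C¹([-h,∞); H)`, with the derivative `v`
of `u` (one-sided at `-h`). The values at times before `-h` play no role. -/
structure Trajectory (h : ℝ) where
  u : ℝ → hA.Energy
  v : ℝ → H
  u_cont : ContinuousOn u (Ici (-h))
  v_cont : ContinuousOn v (Ici (-h))
  hasDeriv : ∀ t ∈ Ici (-h), HasDerivWithinAt (fun s => hA.incl (u s)) (v t) (Ici (-h)) t

/-- The history `u_t ∈ W` for `t ≥ 0`, where `u_t(θ) = u(t + θ)` for `θ ∈ [-h,0]`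
(for `t < 0` the value is `u_0` by convention). -/
def Trajectory.hist {hA : PositiveDiscrete A} {h : ℝ} (U : hA.Trajectory h) (t : ℝ) :
    hA.phaseSpace h :=
  ⟨(⟨fun θ => U.u (max t 0 + θ), U.u_cont.comp_continuous (by fun_prop)
      (fun θ => by have := θ.2.1; have := le_max_right t 0; simp only [mem_Ici]; linarith)⟩,
    ⟨fun θ => U.v (max t 0 + θ), U.v_cont.comp_continuous (by fun_prop)
      (fun θ => by have := θ.2.1; have := le_max_right t 0; simp only [mem_Ici]; linarith)⟩), by
    intro θ
    have hmaps : MapsTo (fun s : ℝ => max t 0 + s) (Icc (-h) 0) (Ici (-h)) := fun s hs => by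
      have := hs.1; have := le_max_right t 0; simp only [mem_Ici]; linarith
    refine ⟨fun s => hA.incl (U.u (max t 0 + s)), fun s => rfl, ?_⟩
    have h1 : HasDerivWithinAt (fun s : ℝ => max t 0 + s) 1 (Icc (-h) 0) θ :=
      (hasDerivWithinAt_id _ _).const_add _
    have h2 := (U.hasDeriv _ (hmaps θ.2)).scomp (θ : ℝ) h1 hmaps
    rw [one_smul] at h2
    exact h2⟩

/-- `U` is a mild solution on `[0,∞)` of `u'' + k u' + A u + F(u) + M(u_t) = 0` with the initial
data `u_0 = φ`, that is `U(t) = e^{-t𝒜} U(0) + ∫₀ᵗ e^{-(t-s)𝒜} (0, -F(u(s)) - M(u_s)) ds` for the pair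
`U = (u, u')`. Since `D(A^{1/2}) × H` is continuously embedded in `H × H`, the identity may be read
in `H × H`. -/
def IsMildSolution {h : ℝ} (k : ℝ) (F : hA.Energy → H) (M : hA.phaseSpace h → H)
    (φ : hA.phaseSpace h) (U : hA.Trajectory h) : Prop :=
  U.hist 0 = φ ∧
  ∀ t : ℝ, 0 ≤ t → (hA.incl (U.u t), U.v t) =
    hA.semigroup k t (hA.incl (U.u 0), U.v 0) +
      ∫ s in (0 : ℝ)..t, hA.semigroup k (t - s) (0, -(F (U.u s) + M (U.hist s)))

/-- The local Lipschitz property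
`‖F(u¹) - F(u²)‖ ≤ L_R ‖A^{1/2-η}(u¹ - u²)‖` whenever `‖A^{1/2} uⁱ‖ ≤ R`. -/
def LocLipschitz (F : hA.Energy → H) (η : ℝ≥0) : Prop :=
  ∀ R : ℝ, 0 < R → ∃ L : ℝ, 0 < L ∧ ∀ u₁ u₂ : hA.Energy, ‖u₁‖ ≤ R → ‖u₂‖ ≤ R →
    ‖F u₁ - F u₂‖ ≤ L * ‖hA.lowPow η (u₁ - u₂)‖

/-- `F` is subcritical. -/
def Subcritical (F : hA.Energy → H) : Prop := ∃ η : ℝ≥0, 0 < η ∧ hA.LocLipschitz F η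

/-- `F` is critical. -/
def Critical (F : hA.Energy → H) : Prop := hA.LocLipschitz F 0

/-- `F : D(A^{1/2}) → H` is locally Lipschitz. -/
def HypF1 (F : hA.Energy → H) : Prop :=
  ∀ R : ℝ, 0 < R → ∃ L : ℝ, 0 < L ∧ ∀ u₁ u₂ : hA.Energy, ‖u₁‖ ≤ R → ‖u₂‖ ≤ R →
    ‖F u₁ - F u₂‖ ≤ L * ‖u₁ - u₂‖

/-- `F = Π' + F*` with a `C¹` functional `Π = Π₀ + Π₁` on `D(A^{1/2})` and a globally Lipschitz
`F* : D(A^{1/2}) → H`, where `Π₀ ≥ 0` is bounded on bounded sets and `Π₁` is dominated by any small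
multiple of `‖A^{1/2}u‖² + Π₀(u)` up to a constant. The derivative of `Π` is taken over the reals;
the functional `Π'(u)` is paired with `v` through the (real part of the) inner product of `H`. -/
def HypF2 (F : hA.Energy → H) : Prop :=
  ∃ (Pot Pot₀ Pot₁ : hA.Energy → ℝ) (Fs : hA.Energy → H) (c₀ : ℝ),
    ContDiff ℝ 1 Pot ∧
    (∀ u v, fderiv ℝ Pot u v = RCLike.re (inner 𝕜 (F u - Fs u) (hA.incl v))) ∧
    (∀ u₁ u₂, ‖Fs u₁ - Fs u₂‖ ^ 2 ≤ c₀ * ‖u₁ - u₂‖ ^ 2) ∧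
    (∀ u, Pot u = Pot₀ u + Pot₁ u) ∧
    (∀ u, 0 ≤ Pot₀ u) ∧
    (∀ r : ℝ, ∃ B : ℝ, ∀ u, ‖u‖ ≤ r → Pot₀ u ≤ B) ∧
    (∀ ε : ℝ, 0 < ε → ∃ C : ℝ, 0 < C ∧ ∀ u, |Pot₁ u| ≤ ε * (‖u‖ ^ 2 + Pot₀ u) + C)

/-- `M : W → H` is locally Lipschitz. -/
def HypM1 {h : ℝ} (M : hA.phaseSpace h → H) : Prop :=
  ∀ r : ℝ, 0 < r → ∃ C : ℝ, 0 < C ∧ ∀ φ₁ φ₂ : hA.phaseSpace h, hA.wNorm φ₁ ≤ r → hA.wNorm φ₂ ≤ r →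
    ‖M φ₁ - M φ₂‖ ≤ C * hA.wNorm (φ₁ - φ₂)

/-- `M` has linear growth. -/
def HypM2 {h : ℝ} (M : hA.phaseSpace h → H) : Prop :=
  ∃ M₀ M₁ : ℝ, 0 ≤ M₀ ∧ 0 ≤ M₁ ∧ ∀ φ : hA.phaseSpace h, ‖M φ‖ ≤ M₀ + M₁ * hA.wNorm φ

/-- The subcritical local Lipschitz property of `M`. The maximum over the compact interval is
written as a supremum; the function of `θ` is continuous. -/
def HypM4 {h : ℝ} (M : hA.phaseSpace h → H) : Prop :=
  ∃ δ : ℝ≥0, 0 < δ ∧ ∀ r : ℝ, 0 < r → ∃ L : ℝ, 0 < L ∧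
    ∀ φ₁ φ₂ : hA.phaseSpace h, hA.wNorm φ₁ ≤ r → hA.wNorm φ₂ ≤ r →
      ‖M φ₁ - M φ₂‖ ≤ L * ⨆ θ : Icc (-h) 0, ‖hA.lowPow δ (φ₁.1.1 θ - φ₂.1.1 θ)‖

/-- `‖u'(t)‖² + ‖A^{1/2} u(t)‖² ≤ R²` for all `t ≥ -h`. -/
def Trajectory.BoundedBy {hA : PositiveDiscrete A} {h : ℝ} (U : hA.Trajectory h) (R : ℝ) : Prop :=
  ∀ t : ℝ, -h ≤ t → ‖U.v t‖ ^ 2 + ‖U.u t‖ ^ 2 ≤ R ^ 2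

/-- The quasi-stability estimate, with the constants `C₁, lam, C₂` and the exponent `1/2 - δ`, for
all pairs of mild solutions bounded by `R`. -/
def QuasiStable {h : ℝ} (k : ℝ) (F : hA.Energy → H) (M : hA.phaseSpace h → H)
    (R : ℝ) (δ : ℝ≥0) (lam C₁ C₂ : ℝ) : Prop :=
  ∀ (φ₁ φ₂ : hA.phaseSpace h) (U₁ U₂ : hA.Trajectory h),
    hA.IsMildSolution k F M φ₁ U₁ → hA.IsMildSolution k F M φ₂ U₂ →
    U₁.BoundedBy R → U₂.BoundedBy R →
    ∀ t : ℝ, 0 ≤ t →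
      ‖U₁.v t - U₂.v t‖ ^ 2 + ‖U₁.u t - U₂.u t‖ ^ 2 ≤
        C₁ * Real.exp (-lam * t) * hA.wNorm (φ₁ - φ₂) ^ 2 +
          C₂ * ⨆ ξ : Icc (0 : ℝ) t, ‖hA.lowPow δ (U₁.u ξ - U₂.u ξ)‖ ^ 2

end PositiveDiscrete

end DelayWave

end

/-! The difference `z` of two bounded solutions solves the linear damped wave equation `z'' + k z' +
A z = G`, where `G` collects the increments of `F` and `M` with a minus sign. Mild solutions need
not be regular enough for the usual multipliers, so the energy argument is run on each eigenmode:
the coefficients along `eₙ` satisfy a genuine scalar oscillator equation (`inner_mild`,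
`hasDerivAt_duhamel`), and the estimates are summed by Parseval (`energy_inequality`).

For one mode the energy perturbed by `4ε (z, v)` is dissipated at rate `ε` (`oscillator_energy_le`).
The cost is `8/k ‖G‖²` plus `8 ε² k ‖z‖²`. The latter involves only the `H`-norm, hence is of lower
order, so `ε` need not shrink as `k` grows; the factor `1/k` is what lets large damping defeat a
critical `F`.

The increment of `M` is of lower order too. The part of the history after time `0` is controlled by
the maximum over `[0,t]`; the part before time `0` matters only while `s < h`, and is charged to the
initial data with a decaying weight. A Grönwall argument (`decay_of_energy_inequality`) absorbs the
remaining `ε/2` times the energy and leaves the decay rate `ε/2`.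

For subcritical `F` the whole increment is of lower order and any `k > 0` works; for critical `F`,
`k` is taken so large that `16/k` times the squared Lipschitz constant is at most `ε/2`. -/

namespace DelayWave.PositiveDiscrete

/-! ### The damped scalar oscillator. -/

section Mode

lemma modeExp_zero (k m : ℝ) : modeExp k 0 m = 1 := by
  simp [modeExp]

lemma modeExp_add (k s t m : ℝ) : modeExp k (s + t) m = modeExp k s m * modeExp k t m := by
  unfold modeExp
  rw [← Matrix.exp_add_of_commute]
  · congr 1
    rw [← add_smul]
    congr 1
    ring
  · exact ((Commute.refl _).smul_left _).smul_right _

open scoped Matrix.Norms.Operator in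
lemma hasDerivAt_modeExp (k t m : ℝ) (i j : Fin 2) :
    HasDerivAt (fun t => modeExp k t m i j)
      (-(!![0, -1; m, k] * modeExp k t m : Matrix (Fin 2) (Fin 2) ℝ) i j) t := by
  have h1 : HasDerivAt (fun t : ℝ => modeExp k t m)
      ((-1 : ℝ) • ((!![0, -1; m, k] : Matrix (Fin 2) (Fin 2) ℝ) * modeExp k t m)) t :=
    (hasDerivAt_exp_smul_const' (𝕂 := ℝ) (!![0, -1; m, k] : Matrix (Fin 2) (Fin 2) ℝ)
      (-t)).scomp t (hasDerivAt_neg t)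
  have h2 : HasDerivAt (fun t : ℝ => modeExp k t m i j) _ t :=
    hasDerivAt_pi.1 (hasDerivAt_pi.1 h1 i) j
  convert h2 using 1
  simp

lemma hasDerivAt_modeExp_zero (k t m : ℝ) (j : Fin 2) :
    HasDerivAt (fun t => modeExp k t m 0 j) (modeExp k t m 1 j) t := by
  convert hasDerivAt_modeExp k t m 0 j using 1
  simp [Matrix.mul_apply, Fin.sum_univ_two]

lemma hasDerivAt_modeExp_one (k t m : ℝ) (j : Fin 2) :
    HasDerivAt (fun t => modeExp k t m 1 j) (-(m * modeExp k t m 0 j) - k * modeExp k t m 1 j) t := by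
  convert hasDerivAt_modeExp k t m 1 j using 1
  simp [Matrix.mul_apply, Fin.sum_univ_two]
  ring

lemma continuous_modeExp (k m : ℝ) (i j : Fin 2) : Continuous fun t => modeExp k t m i j :=
  continuous_iff_continuousAt.2 fun t => (hasDerivAt_modeExp k t m i j).continuousAt

/-- The energy of a column of the matrix exponential does not increase. -/
lemma modeExp_energy_le {k : ℝ} (hk : 0 ≤ k) {t : ℝ} (ht : 0 ≤ t) (m : ℝ) (j : Fin 2) :
    m * modeExp k t m 0 j ^ 2 + modeExp k t m 1 j ^ 2 ≤
      m * modeExp k 0 m 0 j ^ 2 + modeExp k 0 m 1 j ^ 2 := by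
  have hd : ∀ t, HasDerivAt (fun t => m * modeExp k t m 0 j ^ 2 + modeExp k t m 1 j ^ 2)
      (-(2 * k * modeExp k t m 1 j ^ 2)) t := fun t => by
    refine ((((hasDerivAt_modeExp_zero k t m j).pow 2).const_mul m).add
      ((hasDerivAt_modeExp_one k t m j).pow 2)).congr_deriv ?_
    simp only [Nat.cast_ofNat, Nat.add_one_sub_one, pow_one]
    ring
  refine antitone_of_hasDerivAt_nonpos hd (fun t => ?_) ht
  have := mul_nonneg hk (sq_nonneg (modeExp k t m 1 j))
  simp only [Pi.zero_apply]
  linarith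

variable {E : Type*} [NormedAddCommGroup E]

/-- The variation of constants formula solves the oscillator equation. -/
lemma hasDerivAt_duhamel [NormedSpace ℝ E] [CompleteSpace E] (k m : ℝ) (x₀ x₁ : E) {g : ℝ → E}
    (hg : Continuous g) (t : ℝ) :
    let q : Fin 2 → ℝ → E := fun i t => modeExp k t m i 0 • x₀ + modeExp k t m i 1 • x₁ +
      ∫ s in (0 : ℝ)..t, modeExp k (t - s) m i 1 • g s
    HasDerivAt (q 0) (q 1 t) t ∧ HasDerivAt (q 1) (-(m • q 0 t) - k • q 1 t + g t) t := by
  intro q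
  let y : Fin 2 → ℝ → E := fun l t => ∫ s in (0 : ℝ)..t, modeExp k (-s) m l 1 • g s
  have hcont : ∀ l, Continuous fun s => modeExp k (-s) m l 1 • g s := fun l =>
    ((continuous_modeExp k m l 1).comp continuous_neg).smul hg
  have hy : ∀ l, HasDerivAt (y l) (modeExp k (-t) m l 1 • g t) t := fun l =>
    (hcont l).integral_hasStrictDerivAt 0 t |>.hasDerivAt
  -- The group law splits `modeExp k (t - s)` into factors in `t` and `-s`, so that `t` leaves the
  -- integrand and the fundamental theorem of calculus applies.
  have hq : ∀ i, q i = fun t => modeExp k t m i 0 • (x₀ + y 0 t) +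
      modeExp k t m i 1 • (x₁ + y 1 t) := by
    intro i
    ext t
    have h1 : ∀ s, modeExp k (t - s) m i 1 • g s =
        modeExp k t m i 0 • (modeExp k (-s) m 0 1 • g s) +
          modeExp k t m i 1 • (modeExp k (-s) m 1 1 • g s) := fun s => by
      rw [sub_eq_add_neg, modeExp_add, Matrix.mul_apply, Fin.sum_univ_two, add_smul, mul_smul,
        mul_smul]
    simp only [q, h1]
    have h2 := intervalIntegral.integral_add (μ := MeasureTheory.volume)
      (((hcont 0).const_smul (modeExp k t m i 0)).intervalIntegrable 0 t)
      (((hcont 1).const_smul (modeExp k t m i 1)).intervalIntegrable 0 t)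
    simp only [Pi.smul_apply] at h2
    rw [h2, intervalIntegral.integral_smul, intervalIntegral.integral_smul, smul_add, smul_add]
    abel
  -- The boundary terms combine into the second column `(0, 1)` of the identity matrix: the forcing
  -- enters the velocity equation only.
  have hinv : modeExp k t m * modeExp k (-t) m = 1 := by
    rw [← modeExp_add, add_neg_cancel, modeExp_zero]
  have h01 : modeExp k t m 0 0 * modeExp k (-t) m 0 1 + modeExp k t m 0 1 * modeExp k (-t) m 1 1
      = 0 := by
    have := congrFun (congrFun hinv 0) 1
    simpa [Matrix.mul_apply, Fin.sum_univ_two] using this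
  have h11 : modeExp k t m 1 0 * modeExp k (-t) m 0 1 + modeExp k t m 1 1 * modeExp k (-t) m 1 1
      = 1 := by
    have := congrFun (congrFun hinv 1) 1
    simpa [Matrix.mul_apply, Fin.sum_univ_two] using this
  rw [hq 0, hq 1]
  constructor
  · refine (((hasDerivAt_modeExp_zero k t m 0).smul ((hy 0).const_add x₀)).add
      ((hasDerivAt_modeExp_zero k t m 1).smul ((hy 1).const_add x₁))).congr_deriv ?_
    have := congrArg (fun r : ℝ => r • g t) h01
    simp only [add_smul, mul_smul, zero_smul] at this
    rw [add_add_add_comm, this, zero_add]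
  · refine (((hasDerivAt_modeExp_one k t m 0).smul ((hy 0).const_add x₀)).add
      ((hasDerivAt_modeExp_one k t m 1).smul ((hy 1).const_add x₁))).congr_deriv ?_
    have := congrArg (fun r : ℝ => r • g t) h11
    simp only [add_smul, mul_smul, one_smul] at this
    rw [add_add_add_comm, this]
    module

/-- The energy estimate for a damped oscillator with forcing. -/
lemma oscillator_energy_le [InnerProductSpace ℝ E] {k m ε : ℝ} (hε : 0 < ε) (hk : 4 * ε ≤ k)
    (hm : 4 * ε ^ 2 ≤ m) {z v g : ℝ → E} (hg : Continuous g)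
    (hz : ∀ t, HasDerivAt z (v t) t)
    (hv : ∀ t, HasDerivAt v (-(m • z t) - k • v t + g t) t) {t : ℝ} (ht : 0 ≤ t) :
    (‖v t‖ ^ 2 + m * ‖z t‖ ^ 2) * Real.exp (ε * t) ≤ 4 * (‖v 0‖ ^ 2 + m * ‖z 0‖ ^ 2) +
      ∫ s in (0 : ℝ)..t, Real.exp (ε * s) * (8 / k * ‖g s‖ ^ 2 + 8 * ε ^ 2 * k * ‖z s‖ ^ 2) := by
  have hk0 : 0 < k := by linarith
  have hzc : Continuous z := continuous_iff_continuousAt.2 fun t => (hz t).continuousAt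
  have hvc : Continuous v := continuous_iff_continuousAt.2 fun t => (hv t).continuousAt
  -- Lyapunov functional: damping alone dissipates only `‖v‖²`; the derivative of the cross term
  -- supplies `-4εm ‖z‖²`.
  let e : ℝ → ℝ := fun t => 2 * ‖v t‖ ^ 2 + 2 * m * ‖z t‖ ^ 2 + 4 * ε * inner ℝ (z t) (v t)
  -- Since `4ε² ≤ m`, the cross term is at most the energy, so `e` lies between one and three times
  -- the energy.
  have he : ∀ t, |4 * ε * inner ℝ (z t) (v t)| ≤ ‖v t‖ ^ 2 + m * ‖z t‖ ^ 2 := fun t => by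
    rw [abs_mul, abs_of_pos (by positivity : 0 < 4 * ε)]
    have h1 := abs_real_inner_le_norm (z t) (v t)
    nlinarith [sq_nonneg (2 * ε * ‖z t‖ - ‖v t‖), mul_le_mul_of_nonneg_left h1 hε.le,
      mul_le_mul_of_nonneg_right hm (sq_nonneg ‖z t‖)]
  have hd : ∀ t, HasDerivAt (fun t => Real.exp (ε * t) * e t)
      (Real.exp (ε * t) * ε * e t + Real.exp (ε * t) * (
        2 * (2 * inner ℝ (v t) (-(m • z t) - k • v t + g t)) + 2 * m * (2 * inner ℝ (z t) (v t)) +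
        4 * ε * (inner ℝ (z t) (-(m • z t) - k • v t + g t) + inner ℝ (v t) (v t)))) t := fun t => by
    have h1 : HasDerivAt (fun t => Real.exp (ε * t)) (Real.exp (ε * t) * ε) t := by
      simpa using ((hasDerivAt_id t).const_mul ε).exp
    exact h1.mul ((((hv t).norm_sq.const_mul 2).add ((hz t).norm_sq.const_mul (2 * m))).add
      (((hz t).inner ℝ (hv t)).const_mul (4 * ε)))
  have hmain := intervalIntegral.sub_le_integral_of_hasDeriv_right_of_le ht
    (fun t _ => (hd t).continuousAt.continuousWithinAt)
    (fun t _ => (hd t).hasDerivWithinAt)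
    (φ := fun s => Real.exp (ε * s) * (8 / k * ‖g s‖ ^ 2 + 8 * ε ^ 2 * k * ‖z s‖ ^ 2))
    (Continuous.integrableOn_Icc (by fun_prop)) ?_
  · have h1 := (abs_le.1 (he t)).1
    have h2 := (abs_le.1 (he 0)).2
    have h3 : (‖v t‖ ^ 2 + m * ‖z t‖ ^ 2) * Real.exp (ε * t) ≤ Real.exp (ε * t) * e t := by
      rw [mul_comm]
      exact mul_le_mul_of_nonneg_left (by simp only [e]; linarith) (Real.exp_pos _).le
    have hS : 0 ≤ ‖v 0‖ ^ 2 + m * ‖z 0‖ ^ 2 := (abs_nonneg _).trans (he 0)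
    have h4 : Real.exp (ε * 0) * e 0 ≤ 4 * (‖v 0‖ ^ 2 + m * ‖z 0‖ ^ 2) := by
      simp only [e, mul_zero, Real.exp_zero, one_mul]
      linarith
    linarith
  · intro s _
    rw [mul_assoc, ← mul_add]
    refine mul_le_mul_of_nonneg_left ?_ (Real.exp_pos _).le
    have h2 := (abs_le.1 (he s)).2
    have hvg := abs_real_inner_le_norm (v s) (g s)
    have hzg := abs_real_inner_le_norm (z s) (g s)
    have hzv := abs_real_inner_le_norm (z s) (v s)
    have hvg' := (abs_le.1 hvg).2
    have hzg' := (abs_le.1 hzg).2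
    have hzv' := (abs_le.1 hzv).1
    simp only [e, inner_add_right, inner_sub_right, inner_neg_right, inner_smul_right,
      real_inner_self_eq_norm_sq, real_inner_comm (z s) (v s)] at *
    -- In `e' + ε e` the terms `4m (z, v)` cancel. Young's inequalities `q1`, `q2`, `q3` then leave
    -- at most `(-2k + 7ε) ‖v‖²`, nonpositive as `4ε ≤ k`, `-εm ‖z‖²`, and `5ε²k ‖z‖² + 8/k ‖g‖²`.
    have q1 : 4 * (‖v s‖ * ‖g s‖) ≤ k * ‖v s‖ ^ 2 + 4 / k * ‖g s‖ ^ 2 := by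
      have : k * ‖v s‖ ^ 2 + 4 / k * ‖g s‖ ^ 2 - 4 * (‖v s‖ * ‖g s‖) =
        (k * ‖v s‖ - 2 * ‖g s‖) ^ 2 / k := by field_simp; ring
      have : 0 ≤ (k * ‖v s‖ - 2 * ‖g s‖) ^ 2 / k := by positivity
      linarith
    have q2 : 4 * ε * (‖z s‖ * ‖g s‖) ≤ ε ^ 2 * k * ‖z s‖ ^ 2 + 4 / k * ‖g s‖ ^ 2 := by
      have : ε ^ 2 * k * ‖z s‖ ^ 2 + 4 / k * ‖g s‖ ^ 2 - 4 * ε * (‖z s‖ * ‖g s‖) =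
        (ε * k * ‖z s‖ - 2 * ‖g s‖) ^ 2 / k := by field_simp; ring
      have : 0 ≤ (ε * k * ‖z s‖ - 2 * ‖g s‖) ^ 2 / k := by positivity
      linarith
    have q3 : 4 * ε * k * (‖z s‖ * ‖v s‖) ≤ 4 * ε ^ 2 * k * ‖z s‖ ^ 2 + k * ‖v s‖ ^ 2 := by
      nlinarith [mul_nonneg hk0.le (sq_nonneg (2 * ε * ‖z s‖ - ‖v s‖))]
    have q4 : 8 / k * ‖g s‖ ^ 2 = 4 / k * ‖g s‖ ^ 2 + 4 / k * ‖g s‖ ^ 2 := by ring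
    have q5 := mul_le_mul_of_nonneg_left hzg' (by positivity : 0 ≤ 4 * ε)
    have q6 := mul_le_mul_of_nonneg_left hzv' (by positivity : 0 ≤ 4 * ε * k)
    have q7 := mul_le_mul_of_nonneg_left h2 hε.le
    have q8 : 0 ≤ ε ^ 2 * k * ‖z s‖ ^ 2 := by positivity
    have q9 := mul_le_mul_of_nonneg_right hk (sq_nonneg ‖v s‖)
    have q10 : 0 ≤ ε * m * ‖z s‖ ^ 2 := by
      have : 0 ≤ m := le_trans (by positivity) hm
      positivity
    nlinarith
end Mode

end DelayWave.PositiveDiscrete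

namespace DelayWave.PositiveDiscrete

variable {𝕜 H : Type*} [RCLike 𝕜] [NormedAddCommGroup H] [InnerProductSpace 𝕜 H] [CompleteSpace H]
  {A : H →ₗ.[𝕜] H} (hA : PositiveDiscrete A)

/-! ### Parseval identities and comparison of fractional norms. -/

section Spectral

lemma hasSum_sq_norm_inner (x : H) : HasSum (fun n => ‖inner 𝕜 (hA.e n) x‖ ^ 2) (‖x‖ ^ 2) := by
  have h := lp.hasSum_norm (p := 2) (by norm_num) (hA.e.repr x)
  simpa [HilbertBasis.repr_apply_apply] using h

lemma hasSum_sq_norm_pow (α : ℝ) (x : (hA.pow α).domain) :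
    HasSum (fun n => (hA.μ n ^ α * ‖inner 𝕜 (hA.e n) x.1‖) ^ 2) (‖hA.pow α x‖ ^ 2) := by
  have h := lp.hasSum_norm (p := 2) (by norm_num)
    (⟨hA.powCoeff α x.1, x.2⟩ : lp (fun _ : ℕ => 𝕜) 2)
  have h1 : ‖hA.pow α x‖ = ‖(⟨hA.powCoeff α x.1, x.2⟩ : lp (fun _ : ℕ => 𝕜) 2)‖ :=
    hA.e.repr.symm.norm_map _
  rw [h1]
  simpa [powCoeff, HilbertBasis.repr_apply_apply,
    abs_of_nonneg (Real.rpow_nonneg (hA.pos _).le α)] using h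

lemma hasSum_sq_norm_energy (u : hA.Energy) :
    HasSum (fun n => hA.μ n * ‖inner 𝕜 (hA.e n) (hA.incl u)‖ ^ 2) (‖u‖ ^ 2) := by
  have h : HasSum _ (‖u‖ ^ 2) := hA.hasSum_sq_norm_pow (1 / 2) u
  convert h using 2 with n
  rw [mul_pow, ← Real.sqrt_eq_rpow, Real.sq_sqrt (hA.pos n).le]
  rfl

lemma hasSum_sq_norm_lowPow (δ : ℝ≥0) (u : hA.Energy) :
    HasSum (fun n => (hA.μ n ^ (1 / 2 - δ : ℝ) * ‖inner 𝕜 (hA.e n) (hA.incl u)‖) ^ 2)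
      (‖hA.lowPow δ u‖ ^ 2) :=
  hA.hasSum_sq_norm_pow (1 / 2 - δ) ⟨hA.incl u, hA.pow_domain_anti (by simp) u.2⟩

/-- The norms `‖A^{1/2 - δ} u‖` are ordered, up to constants. -/
lemma norm_lowPow_le {δ η : ℝ≥0} (h : δ ≤ η) (u : hA.Energy) :
    ‖hA.lowPow η u‖ ≤ hA.μ 0 ^ (δ - η : ℝ) * ‖hA.lowPow δ u‖ := by
  have hc : 0 ≤ hA.μ 0 ^ (δ - η : ℝ) := Real.rpow_nonneg hA.μ_pos.le _
  refine le_of_sq_le_sq ?_ (mul_nonneg hc (norm_nonneg _))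
  rw [mul_pow]
  refine hasSum_le (fun n => ?_) (hA.hasSum_sq_norm_lowPow η u)
    ((hA.hasSum_sq_norm_lowPow δ u).mul_left _)
  rw [← mul_pow, ← mul_assoc]
  have h1 : hA.μ n ^ (1 / 2 - η : ℝ) = hA.μ n ^ (δ - η : ℝ) * hA.μ n ^ (1 / 2 - δ : ℝ) := by
    rw [← Real.rpow_add (hA.pos n)]
    congr 1
    ring
  have h2 : hA.μ n ^ (δ - η : ℝ) ≤ hA.μ 0 ^ (δ - η : ℝ) :=
    Real.rpow_le_rpow_of_nonpos hA.μ_pos (hA.μ_mono (Nat.zero_le n))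
      (by have : (δ : ℝ) ≤ η := h
          linarith)
  have h3 := Real.rpow_nonneg (hA.pos n).le (1 / 2 - δ : ℝ)
  have h4 := Real.rpow_nonneg (hA.pos n).le (1 / 2 - η : ℝ)
  rw [h1] at h4 ⊢
  gcongr

lemma norm_lowPow_zero (u : hA.Energy) : ‖hA.lowPow 0 u‖ = ‖u‖ := by
  have h := (hA.hasSum_sq_norm_lowPow 0 u).unique (by
    convert hA.hasSum_sq_norm_energy u using 2 with n
    rw [mul_pow, NNReal.coe_zero, sub_zero, ← Real.sqrt_eq_rpow, Real.sq_sqrt (hA.pos n).le])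
  exact (sq_eq_sq₀ (norm_nonneg _) (norm_nonneg _)).1 h

lemma norm_lowPow_half (u : hA.Energy) : ‖hA.lowPow (1 / 2) u‖ = ‖hA.incl u‖ := by
  have h := (hA.hasSum_sq_norm_lowPow (1 / 2) u).unique (by
    convert hA.hasSum_sq_norm_inner (hA.incl u) using 2 with n
    simp)
  exact (sq_eq_sq₀ (norm_nonneg _) (norm_nonneg _)).1 h

lemma norm_lowPow_le_norm (δ : ℝ≥0) (u : hA.Energy) :
    ‖hA.lowPow δ u‖ ≤ hA.μ 0 ^ (-δ : ℝ) * ‖u‖ := by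
  have := hA.norm_lowPow_le (zero_le : 0 ≤ δ) u
  rwa [norm_lowPow_zero, NNReal.coe_zero, zero_sub] at this

lemma norm_incl_le (u : hA.Energy) : ‖hA.incl u‖ ≤ hA.μ 0 ^ (-(1 / 2) : ℝ) * ‖u‖ := by
  have := hA.norm_lowPow_le_norm (1 / 2) u
  rw [norm_lowPow_half] at this
  simpa using this

/-- Riesz-Fischer. -/
lemma exists_hasSum_smul {c : ℕ → 𝕜} (hc : Summable fun n => ‖c n‖ ^ 2) :
    ∃ x : H, HasSum (fun n => c n • hA.e n) x ∧ (∀ n, inner 𝕜 (hA.e n) x = c n) := by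
  have hm : Memℓp c 2 := by
    rw [memℓp_gen_iff (by norm_num)]
    simpa using hc
  refine ⟨hA.e.repr.symm ⟨c, hm⟩, hA.e.hasSum_repr_symm ⟨c, hm⟩, fun n => ?_⟩
  rw [← HilbertBasis.repr_apply_apply, LinearIsometryEquiv.apply_symm_apply]

/-! ### Bounds for the semigroup. -/

variable {k t : ℝ}

/-- The columns of the exponential start from `(1, 0)` and `(0, 1)`, with energies `μₙ` and `1`;
monotonicity of the energy bounds all four entries. Only the lower left one may grow with `n`, like
`√μₙ`, which is why the displacement must lie in `D(A^{1/2})`. -/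
lemma sq_modeExp_zero_zero_le (hk : 0 ≤ k) (ht : 0 ≤ t) (n : ℕ) :
    modeExp k t (hA.μ n) 0 0 ^ 2 ≤ 1 := by
  have h := modeExp_energy_le hk ht (hA.μ n) 0
  have := hA.pos n
  simp only [modeExp_zero, Matrix.one_apply_eq, ne_eq, one_ne_zero, not_false_eq_true,
    Matrix.one_apply_ne] at h
  by_contra! h1
  nlinarith [sq_nonneg (modeExp k t (hA.μ n) 1 0)]

lemma sq_modeExp_one_zero_le (hk : 0 ≤ k) (ht : 0 ≤ t) (n : ℕ) :
    modeExp k t (hA.μ n) 1 0 ^ 2 ≤ hA.μ n := by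
  have h := modeExp_energy_le hk ht (hA.μ n) 0
  have := mul_nonneg (hA.pos n).le (sq_nonneg (modeExp k t (hA.μ n) 0 0))
  simp only [modeExp_zero, Matrix.one_apply_eq, ne_eq, one_ne_zero, not_false_eq_true,
    Matrix.one_apply_ne] at h
  linarith

lemma sq_modeExp_zero_one_le (hk : 0 ≤ k) (ht : 0 ≤ t) (n : ℕ) :
    modeExp k t (hA.μ n) 0 1 ^ 2 ≤ (hA.μ 0)⁻¹ := by
  have h := modeExp_energy_le hk ht (hA.μ n) 1
  have h0 := hA.μ_pos
  have h1 := mul_le_mul_of_nonneg_right (hA.μ_mono (Nat.zero_le n))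
    (sq_nonneg (modeExp k t (hA.μ n) 0 1))
  simp only [modeExp_zero, Matrix.one_apply_eq, ne_eq, zero_ne_one, not_false_eq_true,
    Matrix.one_apply_ne] at h
  rw [← one_div, le_div_iff₀ h0]
  nlinarith [sq_nonneg (modeExp k t (hA.μ n) 1 1)]

lemma sq_modeExp_one_one_le (hk : 0 ≤ k) (ht : 0 ≤ t) (n : ℕ) :
    modeExp k t (hA.μ n) 1 1 ^ 2 ≤ 1 := by
  have h := modeExp_energy_le hk ht (hA.μ n) 1
  have := mul_nonneg (hA.pos n).le (sq_nonneg (modeExp k t (hA.μ n) 0 1))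
  simp only [modeExp_zero, Matrix.one_apply_eq, ne_eq, zero_ne_one, not_false_eq_true,
    Matrix.one_apply_ne] at h
  linarith

lemma summable_sq_norm_add {a b : ℕ → 𝕜} {f g : ℕ → ℝ} (ha : ∀ n, ‖a n‖ ^ 2 ≤ f n)
    (hb : ∀ n, ‖b n‖ ^ 2 ≤ g n) (hf : Summable f) (hg : Summable g) :
    Summable fun n => ‖a n + b n‖ ^ 2 := by
  refine Summable.of_nonneg_of_le (fun n => by positivity) (fun n => ?_)
    ((hf.mul_left 2).add (hg.mul_left 2))
  have h1 := norm_add_le (a n) (b n)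
  have h2 := ha n
  have h3 := hb n
  have h4 : ‖a n + b n‖ ^ 2 ≤ (‖a n‖ + ‖b n‖) ^ 2 := by gcongr
  nlinarith [sq_nonneg (‖a n‖ - ‖b n‖)]

lemma sq_norm_ofReal_mul_le {p C : ℝ} (hp : p ^ 2 ≤ C) (x : 𝕜) :
    ‖(p : 𝕜) * x‖ ^ 2 ≤ C * ‖x‖ ^ 2 := by
  rw [norm_mul, mul_pow, RCLike.norm_ofReal, sq_abs]
  gcongr

/-- For `(u, v)` in `D(A^{1/2}) × H` the series that define the semigroup converge. -/
lemma semigroup_spec (hk : 0 ≤ k) (ht : 0 ≤ t) (u : hA.Energy) (v : H) :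
    (HasSum (fun n => (((modeExp k t (hA.μ n) 0 0 : ℝ) : 𝕜) * inner 𝕜 (hA.e n) (hA.incl u) +
      ((modeExp k t (hA.μ n) 0 1 : ℝ) : 𝕜) * inner 𝕜 (hA.e n) v) • hA.e n)
        (hA.semigroup k t (hA.incl u, v)).1 ∧
    HasSum (fun n => (((modeExp k t (hA.μ n) 1 0 : ℝ) : 𝕜) * inner 𝕜 (hA.e n) (hA.incl u) +
      ((modeExp k t (hA.μ n) 1 1 : ℝ) : 𝕜) * inner 𝕜 (hA.e n) v) • hA.e n)
        (hA.semigroup k t (hA.incl u, v)).2) ∧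
    ∀ n, inner 𝕜 (hA.e n) (hA.semigroup k t (hA.incl u, v)).1 =
        ((modeExp k t (hA.μ n) 0 0 : ℝ) : 𝕜) * inner 𝕜 (hA.e n) (hA.incl u) +
          ((modeExp k t (hA.μ n) 0 1 : ℝ) : 𝕜) * inner 𝕜 (hA.e n) v ∧
      inner 𝕜 (hA.e n) (hA.semigroup k t (hA.incl u, v)).2 =
        ((modeExp k t (hA.μ n) 1 0 : ℝ) : 𝕜) * inner 𝕜 (hA.e n) (hA.incl u) +
          ((modeExp k t (hA.μ n) 1 1 : ℝ) : 𝕜) * inner 𝕜 (hA.e n) v := by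
  have hv := (hA.hasSum_sq_norm_inner v).summable
  obtain ⟨x, hx, hx'⟩ := hA.exists_hasSum_smul (summable_sq_norm_add
    (fun n => sq_norm_ofReal_mul_le (hA.sq_modeExp_zero_zero_le hk ht n)
      (inner 𝕜 (hA.e n) (hA.incl u)))
    (fun n => sq_norm_ofReal_mul_le (hA.sq_modeExp_zero_one_le hk ht n) (inner 𝕜 (hA.e n) v))
    ((hA.hasSum_sq_norm_inner (hA.incl u)).summable.mul_left _) (hv.mul_left _))
  obtain ⟨y, hy, hy'⟩ := hA.exists_hasSum_smul (summable_sq_norm_add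
    (fun n => sq_norm_ofReal_mul_le (hA.sq_modeExp_one_zero_le hk ht n)
      (inner 𝕜 (hA.e n) (hA.incl u)))
    (fun n => sq_norm_ofReal_mul_le (hA.sq_modeExp_one_one_le hk ht n) (inner 𝕜 (hA.e n) v))
    (hA.hasSum_sq_norm_energy u).summable (hv.mul_left _))
  have hs : hA.semigroup k t (hA.incl u, v) = (x, y) := Prod.ext hx.tsum_eq hy.tsum_eq
  rw [hs]
  exact ⟨⟨hx, hy⟩, fun n => ⟨hx' n, hy' n⟩⟩

lemma norm_le_of_inner_le {x g : H} {C : ℝ} (hC : 0 ≤ C)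
    (h : ∀ n, ‖inner 𝕜 (hA.e n) x‖ ^ 2 ≤ C * ‖inner 𝕜 (hA.e n) g‖ ^ 2) : ‖x‖ ≤ √C * ‖g‖ := by
  refine le_of_sq_le_sq ?_ (by positivity)
  rw [mul_pow, Real.sq_sqrt hC]
  exact hasSum_le h (hA.hasSum_sq_norm_inner x) ((hA.hasSum_sq_norm_inner g).mul_left C)

/-- The bound does not depend on `t`, so it dominates the integrand of the Duhamel term. -/
lemma norm_semigroup_zero_le (hk : 0 ≤ k) (ht : 0 ≤ t) (g : H) :
    ‖hA.semigroup k t (0, g)‖ ≤ (√((hA.μ 0)⁻¹) + 1) * ‖g‖ := by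
  have h := (hA.semigroup_spec hk ht 0 g).2
  simp only [map_zero, inner_zero_right, mul_zero, zero_add] at h
  have h0 := hA.μ_pos
  have h1 := hA.norm_le_of_inner_le (x := (hA.semigroup k t (0, g)).1) (g := g)
    (inv_nonneg.2 h0.le) fun n => by
      rw [(h n).1]
      exact sq_norm_ofReal_mul_le (hA.sq_modeExp_zero_one_le hk ht n) _
  have h2 := hA.norm_le_of_inner_le (x := (hA.semigroup k t (0, g)).2) (g := g)
    zero_le_one fun n => by
      rw [(h n).2]
      exact sq_norm_ofReal_mul_le (hA.sq_modeExp_one_one_le hk ht n) _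
  rw [Real.sqrt_one, one_mul] at h2
  rw [add_mul, one_mul]
  refine max_le (h1.trans ?_) (h2.trans ?_)
  · exact le_add_of_nonneg_right (norm_nonneg _)
  · exact le_add_of_nonneg_left (by positivity)

end Spectral

end DelayWave.PositiveDiscrete

/-! ### Grönwall inequality and decay. -/

namespace DelayWave.PositiveDiscrete

/-- Grönwall's inequality in integral form with an exponential inhomogeneity. -/
lemma le_of_le_add_integral {y : ℝ → ℝ} (hy : Continuous y) {a b c t : ℝ} (hb : 0 ≤ b) (hc : 0 < c)
    (ht : 0 ≤ t)
    (h : ∀ s ∈ Icc 0 t, y s ≤ a + b * Real.exp (2 * c * s) + c * ∫ τ in (0 : ℝ)..s, y τ) :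
    y t ≤ a * Real.exp (c * t) + 2 * b * Real.exp (2 * c * t) := by
  let Y : ℝ → ℝ := fun s => ∫ τ in (0 : ℝ)..s, y τ
  have hY : ∀ s, HasDerivAt Y (y s) s := fun s => (hy.integral_hasStrictDerivAt 0 s).hasDerivAt
  have hexp : ∀ r s : ℝ, HasDerivAt (fun s => Real.exp (r * s)) (Real.exp (r * s) * r) s :=
    fun r s => by simpa using ((hasDerivAt_id s).const_mul r).exp
  -- The integrating factor is corrected by `-b e^{cs}`, which compensates the inhomogeneity and
  -- makes the function nonincreasing.
  have hD : ∀ s, HasDerivAt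
      (fun s => Real.exp (-c * s) * (c * Y s + a + b) - b * Real.exp (c * s))
      (Real.exp (-c * s) * -c * (c * Y s + a + b) + Real.exp (-c * s) * (c * y s) -
        b * (Real.exp (c * s) * c)) s := fun s =>
    ((hexp (-c) s).mul ((((hY s).const_mul c).add_const a).add_const b)).sub
      ((hexp c s).const_mul b)
  have hexp2 : ∀ s, Real.exp (2 * c * s) = Real.exp (c * s) * Real.exp (c * s) := fun s => by
    rw [← Real.exp_add]
    congr 1
    ring
  have hinv : ∀ s, Real.exp (-c * s) * Real.exp (c * s) = 1 := fun s => by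
    rw [← Real.exp_add, neg_mul, neg_add_cancel, Real.exp_zero]
  have h1 := intervalIntegral.sub_le_integral_of_hasDeriv_right_of_le ht
    (fun s _ => (hD s).continuousAt.continuousWithinAt) (fun s _ => (hD s).hasDerivWithinAt)
    (φ := fun _ => 0) (Continuous.integrableOn_Icc continuous_const) fun s hs => by
      have h2 := h s (Ioo_subset_Icc_self hs)
      rw [hexp2] at h2
      have h3 := mul_le_mul_of_nonneg_left h2 (mul_pos hc (Real.exp_pos (-c * s))).le
      have h4 : 0 ≤ c * Real.exp (-c * s) * b := by positivity
      have h5 : c * Real.exp (-c * s) * (b * (Real.exp (c * s) * Real.exp (c * s))) =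
          c * b * Real.exp (c * s) := by
        linear_combination c * b * Real.exp (c * s) * hinv s
      simp only [Y]
      linarith
  have hY0 : Y 0 = 0 := intervalIntegral.integral_same
  simp only [intervalIntegral.integral_zero, mul_zero, Real.exp_zero, hY0, zero_add, one_mul,
    mul_one] at h1
  have h2 := h t (right_mem_Icc.2 ht)
  have h3 : c * Y t + a + b ≤ a * Real.exp (c * t) + b * Real.exp (2 * c * t) := by
    have h4 := mul_le_mul_of_nonneg_right h1 (Real.exp_pos (c * t)).le
    rw [hexp2]
    linear_combination h4 - (c * Y t + a + b) * hinv t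
  simp only [Y] at h3
  linarith

/-- Decay of an energy that satisfies an integrated dissipation inequality whose right-hand side
contains a small multiple of the energy itself. -/
lemma decay_of_energy_inequality {S Q : ℝ → ℝ} (hS : Continuous S) (hQ : Continuous Q)
    {ε S₀ K B W h t : ℝ} (hε : 0 < ε) (hK : 0 ≤ K) (hB : 0 ≤ B) (hW : 0 ≤ W) (ht : 0 ≤ t)
    (hE : ∀ s ∈ Icc 0 t, S s * Real.exp (ε * s) ≤ 4 * S₀ +
      ∫ τ in (0 : ℝ)..s, Real.exp (ε * τ) * Q τ)
    (hSQ : ∀ s ∈ Icc 0 t, Q s ≤ ε / 2 * S s + K * B + K * W * Real.exp (2 * ε * (h - s))) :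
    S t ≤ (4 * S₀ + K * W * Real.exp (2 * ε * h) / ε) * Real.exp (-(ε / 2) * t) +
      2 * K / ε * B := by
  have hexp : ∀ r s : ℝ, HasDerivAt (fun s => Real.exp (r * s)) (Real.exp (r * s) * r) s :=
    fun r s => by simpa using ((hasDerivAt_id s).const_mul r).exp
  -- Grönwall with `c = ε/2` for the weighted energy: its growth `e^{εt/2}` against the weight
  -- `e^{εt}` leaves the decay `e^{-εt/2}`. The term in `B` grows exactly like the weight and yields
  -- a constant; the term in `W` is integrable after weighting and joins `a`.
  have key := le_of_le_add_integral (y := fun s => S s * Real.exp (ε * s))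
    (a := 4 * S₀ + K * W * Real.exp (2 * ε * h) / ε) (b := K * B / ε) (c := ε / 2) (t := t)
    (by fun_prop) (by positivity) (by positivity) ht fun s hs => by
      refine (hE s hs).trans ?_
      have h1 : ∫ τ in (0 : ℝ)..s, Real.exp (ε * τ) * Q τ ≤
          ∫ τ in (0 : ℝ)..s, (ε / 2 * (S τ * Real.exp (ε * τ)) + (K * B * Real.exp (ε * τ) +
            K * W * Real.exp (2 * ε * h) * Real.exp (-ε * τ))) := by
        refine intervalIntegral.integral_mono_on hs.1 (Continuous.intervalIntegrable (by fun_prop) _ _)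
          (Continuous.intervalIntegrable (by fun_prop) _ _) fun τ hτ => ?_
        have h2 := mul_le_mul_of_nonneg_left (hSQ τ ⟨hτ.1, hτ.2.trans hs.2⟩)
          (Real.exp_pos (ε * τ)).le
        have h3 : Real.exp (ε * τ) * Real.exp (2 * ε * (h - τ)) =
            Real.exp (2 * ε * h) * Real.exp (-ε * τ) := by
          rw [← Real.exp_add, ← Real.exp_add]
          congr 1
          ring
        linear_combination h2 + K * W * h3
      have h4 : ∫ τ in (0 : ℝ)..s, (K * B * Real.exp (ε * τ) +
            K * W * Real.exp (2 * ε * h) * Real.exp (-ε * τ)) =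
          (K * B / ε * Real.exp (ε * s) - K * W * Real.exp (2 * ε * h) / ε * Real.exp (-ε * s)) -
          (K * B / ε * Real.exp (ε * 0) -
            K * W * Real.exp (2 * ε * h) / ε * Real.exp (-ε * 0)) := by
        refine intervalIntegral.integral_eq_sub_of_hasDerivAt (f := fun s =>
          K * B / ε * Real.exp (ε * s) - K * W * Real.exp (2 * ε * h) / ε * Real.exp (-ε * s))
          (fun τ _ => ?_)
          (Continuous.intervalIntegrable (by fun_prop) _ _)
        refine (((hexp ε τ).const_mul _).sub ((hexp (-ε) τ).const_mul _)).congr_deriv ?_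
        field_simp
        ring
      rw [intervalIntegral.integral_add (Continuous.intervalIntegrable (by fun_prop) _ _)
        (Continuous.intervalIntegrable (by fun_prop) _ _), h4,
        intervalIntegral.integral_const_mul] at h1
      simp only [mul_zero, Real.exp_zero, mul_one] at h1
      have h5 : 0 ≤ K * W * Real.exp (2 * ε * h) / ε * Real.exp (-ε * s) := by positivity
      have h6 : 0 ≤ K * B / ε := by positivity
      rw [mul_div_cancel₀ ε two_ne_zero]
      linarith
  rw [mul_div_cancel₀ ε two_ne_zero] at key
  have h1 := mul_le_mul_of_nonneg_right key (Real.exp_pos (-ε * t)).le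
  have h2 : Real.exp (ε * t) * Real.exp (-ε * t) = 1 := by
    rw [← Real.exp_add, neg_mul, add_neg_cancel, Real.exp_zero]
  have h3 : Real.exp (ε / 2 * t) * Real.exp (-ε * t) = Real.exp (-(ε / 2) * t) := by
    rw [← Real.exp_add]
    congr 1
    ring
  rw [← h3]
  have h4 : 2 * K / ε * B = 2 * (K * B / ε) := by ring
  rw [h4]
  linear_combination h1 + (2 * (K * B / ε) - S t) * h2

variable {𝕜 H : Type*} [RCLike 𝕜] [NormedAddCommGroup H] [InnerProductSpace 𝕜 H] [CompleteSpace H]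
  {A : H →ₗ.[𝕜] H} (hA : PositiveDiscrete A)

/-! ### From mild solutions to modes and back. -/

section Mild

variable {k : ℝ}

/-- Allows the Duhamel integral to be tested against `eₙ`. Measurability comes from continuous
partial sums converging pointwise, so strong continuity of the semigroup is never needed. -/
lemma intervalIntegrable_semigroup (hk : 0 ≤ k) {t : ℝ} (ht : 0 ≤ t) {G : ℝ → H}
    (hG : Continuous G) :
    IntervalIntegrable (fun s => hA.semigroup k (t - s) (0, G s)) MeasureTheory.volume 0 t := by
  rw [intervalIntegrable_iff_integrableOn_Ioc_of_le ht]
  let f : ℕ → ℝ → H × H := fun N s =>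
    (∑ n ∈ Finset.range N, (((modeExp k (t - s) (hA.μ n) 0 1 : ℝ) : 𝕜) *
      inner 𝕜 (hA.e n) (G s)) • hA.e n,
     ∑ n ∈ Finset.range N, (((modeExp k (t - s) (hA.μ n) 1 1 : ℝ) : 𝕜) *
      inner 𝕜 (hA.e n) (G s)) • hA.e n)
  have hc : ∀ n i, Continuous fun s => (((modeExp k (t - s) (hA.μ n) i 1 : ℝ) : 𝕜) *
      inner 𝕜 (hA.e n) (G s)) • hA.e n := fun n i =>
    ((RCLike.continuous_ofReal.comp ((continuous_modeExp k (hA.μ n) i 1).comp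
      (continuous_const.sub continuous_id))).mul (continuous_const.inner hG)).smul continuous_const
  have hf : ∀ N, Continuous (f N) := fun N =>
    (continuous_finsetSum _ fun n _ => hc n 0).prodMk (continuous_finsetSum _ fun n _ => hc n 1)
  refine MeasureTheory.Integrable.mono'
    (g := fun s => (√((hA.μ 0)⁻¹) + 1) * ‖G s‖) ?_ ?_ ?_
  · exact (Continuous.integrableOn_Icc (by fun_prop)).mono_set Ioc_subset_Icc_self
  · refine aestronglyMeasurable_of_tendsto_ae atTop (fun N => (hf N).aestronglyMeasurable) ?_
    filter_upwards [MeasureTheory.ae_restrict_mem measurableSet_Ioc] with s hs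
    have h := (hA.semigroup_spec hk (sub_nonneg.2 hs.2) 0 (G s)).1
    simp only [map_zero, inner_zero_right, mul_zero, zero_add] at h
    exact h.1.tendsto_sum_nat.prodMk_nhds h.2.tendsto_sum_nat
  · filter_upwards [MeasureTheory.ae_restrict_mem measurableSet_Ioc] with s hs
    exact hA.norm_semigroup_zero_le hk (sub_nonneg.2 hs.2) (G s)

/-- The integrated dissipation inequality for a linear damped equation, whose solution is given
through the variation of constants formula for its coefficients. -/
lemma energy_inequality {ε : ℝ} (hε : 0 < ε) (hk : 4 * ε ≤ k) (hμ : 4 * ε ^ 2 ≤ hA.μ 0)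
    {G v : ℝ → H} {z : ℝ → hA.Energy} (hG : Continuous G) (hz : Continuous fun s => hA.incl (z s))
    (hzv : ∀ t, 0 ≤ t → ∀ n,
      inner 𝕜 (hA.e n) (hA.incl (z t)) =
        modeExp k t (hA.μ n) 0 0 • inner 𝕜 (hA.e n) (hA.incl (z 0)) +
        modeExp k t (hA.μ n) 0 1 • inner 𝕜 (hA.e n) (v 0) +
        ∫ s in (0 : ℝ)..t, modeExp k (t - s) (hA.μ n) 0 1 • inner 𝕜 (hA.e n) (G s) ∧
      inner 𝕜 (hA.e n) (v t) = modeExp k t (hA.μ n) 1 0 • inner 𝕜 (hA.e n) (hA.incl (z 0)) +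
        modeExp k t (hA.μ n) 1 1 • inner 𝕜 (hA.e n) (v 0) +
        ∫ s in (0 : ℝ)..t, modeExp k (t - s) (hA.μ n) 1 1 • inner 𝕜 (hA.e n) (G s))
    {t : ℝ} (ht : 0 ≤ t) :
    (‖v t‖ ^ 2 + ‖z t‖ ^ 2) * Real.exp (ε * t) ≤ 4 * (‖v 0‖ ^ 2 + ‖z 0‖ ^ 2) +
      ∫ s in (0 : ℝ)..t, Real.exp (ε * s) *
        (8 / k * ‖G s‖ ^ 2 + 8 * ε ^ 2 * k * ‖hA.incl (z s)‖ ^ 2) := by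
  have hk0 : 0 < k := by linarith
  have hsum : ∀ t, HasSum (fun n => ‖inner 𝕜 (hA.e n) (v t)‖ ^ 2 +
      hA.μ n * ‖inner 𝕜 (hA.e n) (hA.incl (z t))‖ ^ 2) (‖v t‖ ^ 2 + ‖z t‖ ^ 2) := fun t =>
    (hA.hasSum_sq_norm_inner (v t)).add (hA.hasSum_sq_norm_energy (z t))
  have hpos : ∀ t n, 0 ≤ ‖inner 𝕜 (hA.e n) (v t)‖ ^ 2 +
      hA.μ n * ‖inner 𝕜 (hA.e n) (hA.incl (z t))‖ ^ 2 := fun t n => by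
    have := hA.pos n
    positivity
  -- It suffices to bound finite sums of modes, so that only finite sums are exchanged with the
  -- integral.
  refine hasSum_le_of_sum_le ((hsum t).mul_right (Real.exp (ε * t))) fun s => ?_
  have hcG : ∀ n, Continuous fun τ => inner 𝕜 (hA.e n) (G τ) := fun n =>
    continuous_const.inner hG
  have hcz : ∀ n, Continuous fun τ => inner 𝕜 (hA.e n) (hA.incl (z τ)) := fun n =>
    continuous_const.inner hz
  have hmode : ∀ n, (‖inner 𝕜 (hA.e n) (v t)‖ ^ 2 +
      hA.μ n * ‖inner 𝕜 (hA.e n) (hA.incl (z t))‖ ^ 2) * Real.exp (ε * t) ≤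
      4 * (‖inner 𝕜 (hA.e n) (v 0)‖ ^ 2 +
      hA.μ n * ‖inner 𝕜 (hA.e n) (hA.incl (z 0))‖ ^ 2) +
      ∫ τ in (0 : ℝ)..t, Real.exp (ε * τ) * (8 / k * ‖inner 𝕜 (hA.e n) (G τ)‖ ^ 2 +
        8 * ε ^ 2 * k * ‖inner 𝕜 (hA.e n) (hA.incl (z τ))‖ ^ 2) := fun n => by
    -- The Duhamel expression solves the oscillator equation on all of `ℝ`, while it agrees with the
    -- coefficients of `z` and `v` only for nonnegative times; the estimate is proved for the former
    -- and transferred on `[0, t]`.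
    have hd := hasDerivAt_duhamel k (hA.μ n) (inner 𝕜 (hA.e n) (hA.incl (z 0)))
      (inner 𝕜 (hA.e n) (v 0)) (hcG n)
    have h1 := oscillator_energy_le hε hk (hμ.trans (hA.μ_mono (Nat.zero_le n))) (hcG n)
      (fun t => (hd t).1) (fun t => (hd t).2) ht
    simp only [← (hzv t ht n).1, ← (hzv t ht n).2, ← (hzv 0 le_rfl n).1,
      ← (hzv 0 le_rfl n).2] at h1
    refine h1.trans_eq ?_
    congr 1
    refine intervalIntegral.integral_congr fun τ hτ => ?_
    rw [uIcc_of_le ht] at hτ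
    simp only [← (hzv τ hτ.1 n).1]
  refine (Finset.sum_le_sum fun n _ => hmode n).trans ?_
  rw [Finset.sum_add_distrib, ← Finset.mul_sum, ← intervalIntegral.integral_finsetSum
    fun n _ => Continuous.intervalIntegrable (by fun_prop) _ _]
  refine add_le_add (mul_le_mul_of_nonneg_left
    (sum_le_hasSum s (fun n _ => hpos 0 n) (hsum 0)) (by norm_num)) ?_
  refine intervalIntegral.integral_mono_on ht (Continuous.intervalIntegrable (by fun_prop) _ _)
    (Continuous.intervalIntegrable (by fun_prop) _ _) fun τ _ => ?_
  rw [← Finset.mul_sum, Finset.sum_add_distrib, ← Finset.mul_sum, ← Finset.mul_sum]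
  have h1 := sum_le_hasSum s (fun n _ => by positivity) (hA.hasSum_sq_norm_inner (G τ))
  have h2 := sum_le_hasSum s (fun n _ => by positivity) (hA.hasSum_sq_norm_inner (hA.incl (z τ)))
  gcongr

variable [NormedSpace ℝ H] [IsScalarTower ℝ 𝕜 H]

/-- The coefficients of a mild solution satisfy the variation of constants formula. -/
lemma inner_mild (hk : 0 ≤ k) {t : ℝ} (ht : 0 ≤ t) {G : ℝ → H} (hG : Continuous G)
    (u : hA.Energy) (v : H) {X : H × H}
    (hX : X = hA.semigroup k t (hA.incl u, v) + ∫ s in (0 : ℝ)..t, hA.semigroup k (t - s) (0, G s))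
    (n : ℕ) :
    inner 𝕜 (hA.e n) X.1 = modeExp k t (hA.μ n) 0 0 • inner 𝕜 (hA.e n) (hA.incl u) +
        modeExp k t (hA.μ n) 0 1 • inner 𝕜 (hA.e n) v +
        ∫ s in (0 : ℝ)..t, modeExp k (t - s) (hA.μ n) 0 1 • inner 𝕜 (hA.e n) (G s) ∧
    inner 𝕜 (hA.e n) X.2 = modeExp k t (hA.μ n) 1 0 • inner 𝕜 (hA.e n) (hA.incl u) +
        modeExp k t (hA.μ n) 1 1 • inner 𝕜 (hA.e n) v +
        ∫ s in (0 : ℝ)..t, modeExp k (t - s) (hA.μ n) 1 1 • inner 𝕜 (hA.e n) (G s) := by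
  have hint := hA.intervalIntegrable_semigroup hk ht hG
  have hs := (hA.semigroup_spec hk ht u v).2 n
  have h0 : ∀ s ∈ uIcc 0 t, _ := fun s hs' =>
    (hA.semigroup_spec hk (sub_nonneg.2 (uIcc_of_le ht ▸ hs' : s ∈ Icc 0 t).2) 0 (G s)).2 n
  simp only [map_zero, inner_zero_right, mul_zero, zero_add] at h0
  let L : H →L[ℝ] 𝕜 := (innerSL 𝕜 (hA.e n)).restrictScalars ℝ
  have h1 := (L.comp (ContinuousLinearMap.fst ℝ H H)).intervalIntegral_comp_comm hint
  have h2 := (L.comp (ContinuousLinearMap.snd ℝ H H)).intervalIntegral_comp_comm hint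
  rw [hX, Prod.fst_add, Prod.snd_add, inner_add_right, inner_add_right, hs.1, hs.2]
  simp only [RCLike.real_smul_eq_coe_mul]
  constructor
  · congr 1
    refine h1.symm.trans (intervalIntegral.integral_congr fun s hs' => (h0 s hs').1)
  · congr 1
    refine h2.symm.trans (intervalIntegral.integral_congr fun s hs' => (h0 s hs').2)

end Mild

end DelayWave.PositiveDiscrete

namespace DelayWave.PositiveDiscrete

variable {𝕜 H : Type*} [RCLike 𝕜] [NormedAddCommGroup H] [InnerProductSpace 𝕜 H] [CompleteSpace H]
  {A : H →ₗ.[𝕜] H} {hA : PositiveDiscrete A}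

lemma continuous_incl (hA : PositiveDiscrete A) : Continuous hA.incl :=
  AddMonoidHomClass.continuous_of_bound hA.incl _ hA.norm_incl_le

variable [NormedSpace ℝ H]

/-! ### Continuity of the history and of the forcing. -/

section Forcing

variable {h : ℝ} {U : hA.Trajectory h} {R : ℝ}

lemma Trajectory.BoundedBy.norm_u_le (hU : U.BoundedBy R) (hR : 0 ≤ R) {t : ℝ} (ht : -h ≤ t) :
    ‖U.u t‖ ≤ R := by
  refine le_of_sq_le_sq ?_ hR
  nlinarith [hU t ht, sq_nonneg ‖U.v t‖]

lemma Trajectory.BoundedBy.norm_v_le (hU : U.BoundedBy R) (hR : 0 ≤ R) {t : ℝ} (ht : -h ≤ t) :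
    ‖U.v t‖ ≤ R := by
  refine le_of_sq_le_sq ?_ hR
  nlinarith [hU t ht, sq_nonneg ‖U.u t‖]

lemma neg_le_max_zero (hh : 0 < h) (s : ℝ) : -h ≤ max s 0 := by
  have := le_max_right s 0
  linarith

/-- Freezing the trajectory at its value at `0` for negative times gives a continuous function on
`ℝ`, in line with the convention of `hist`. -/
lemma Trajectory.continuous_u (U : hA.Trajectory h) (hh : 0 < h) :
    Continuous fun s : ℝ => U.u (max s 0) :=
  U.u_cont.comp_continuous (by fun_prop) fun s => neg_le_max_zero hh s

lemma Trajectory.continuous_v (U : hA.Trajectory h) (hh : 0 < h) :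
    Continuous fun s : ℝ => U.v (max s 0) :=
  U.v_cont.comp_continuous (by fun_prop) fun s => neg_le_max_zero hh s

lemma neg_le_max_add (t : ℝ) (θ : Icc (-h) 0) : -h ≤ max t 0 + θ := by
  have := θ.2.1
  have := le_max_right t 0
  linarith

variable [IsScalarTower ℝ 𝕜 H]

lemma Trajectory.BoundedBy.wNorm_hist_le (hU : U.BoundedBy R) (hR : 0 ≤ R) (t : ℝ) :
    hA.wNorm (U.hist t) ≤ 2 * R := by
  have h1 : ‖(U.hist t).1.1‖ ≤ R := (ContinuousMap.norm_le _ hR).2 fun θ =>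
    hU.norm_u_le hR (neg_le_max_add t θ)
  have h2 : ‖(U.hist t).1.2‖ ≤ R := (ContinuousMap.norm_le _ hR).2 fun θ =>
    hU.norm_v_le hR (neg_le_max_add t θ)
  unfold wNorm
  linarith

/-- Currying: `(t, θ) ↦ u(t + θ)` is jointly continuous, and on the compact `[-h, 0]` the
compact-open topology is that of the maximum norm. -/
lemma Trajectory.continuous_hist (U : hA.Trajectory h) : Continuous U.hist := by
  refine Continuous.subtype_mk (Continuous.prodMk ?_ ?_) _
  · exact (ContinuousMap.curry ⟨fun p : ℝ × Icc (-h) 0 => U.u (max p.1 0 + p.2),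
      U.u_cont.comp_continuous (by fun_prop) fun p => neg_le_max_add p.1 p.2⟩).continuous
  · exact (ContinuousMap.curry ⟨fun p : ℝ × Icc (-h) 0 => U.v (max p.1 0 + p.2),
      U.v_cont.comp_continuous (by fun_prop) fun p => neg_le_max_add p.1 p.2⟩).continuous

lemma continuous_forcing (hh : 0 < h) {F : hA.Energy → H} (hF : hA.HypF1 F)
    {M : hA.phaseSpace h → H} (hM : hA.HypM1 M) (hR : 0 < R) (hU : U.BoundedBy R) :
    Continuous fun s : ℝ => -(F (U.u (max s 0)) + M (U.hist s)) := by
  obtain ⟨L, hL, hFL⟩ := hF R hR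
  obtain ⟨C, hC, hMC⟩ := hM (2 * R) (by positivity)
  have h1 : LipschitzOnWith L.toNNReal F {u | ‖u‖ ≤ R} :=
    LipschitzOnWith.of_dist_le_mul fun u hu v hv => by
      rw [dist_eq_norm, dist_eq_norm, Real.coe_toNNReal _ hL.le]
      exact hFL u v hu hv
  -- The factor `2` compares `wNorm`, a sum of two norms, with the product norm, their maximum.
  have h2 : LipschitzOnWith (2 * C).toNNReal M {φ | hA.wNorm φ ≤ 2 * R} :=
    LipschitzOnWith.of_dist_le_mul fun φ hφ ψ hψ => by
      have h6 : dist φ ψ = ‖φ - ψ‖ := dist_eq_norm φ ψ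
      rw [dist_eq_norm, h6, Real.coe_toNNReal _ (by positivity)]
      refine (hMC φ ψ hφ hψ).trans ?_
      have h3 : ‖(φ - ψ).1.1‖ ≤ ‖φ - ψ‖ := norm_fst_le (φ - ψ).1
      have h4 : ‖(φ - ψ).1.2‖ ≤ ‖φ - ψ‖ := norm_snd_le (φ - ψ).1
      have h5 : hA.wNorm (φ - ψ) ≤ 2 * ‖φ - ψ‖ := by
        unfold wNorm
        linarith
      exact (mul_le_mul_of_nonneg_left h5 hC.le).trans_eq (by ring)
  exact ((h1.continuousOn.comp_continuous (U.continuous_u hh)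
    fun s => hU.norm_u_le hR.le (neg_le_max_zero hh s)).add
    (h2.continuousOn.comp_continuous U.continuous_hist fun s => hU.wNorm_hist_le hR.le s)).neg

/-- The coefficients of a bounded mild solution of the delay equation. -/
lemma IsMildSolution.inner_eq (hh : 0 < h) {k : ℝ} (hk : 0 ≤ k) {F : hA.Energy → H}
    (hF : hA.HypF1 F) {M : hA.phaseSpace h → H} (hM : hA.HypM1 M) (hR : 0 < R)
    (hU : U.BoundedBy R) {φ : hA.phaseSpace h} (hφ : hA.IsMildSolution k F M φ U)
    {t : ℝ} (ht : 0 ≤ t) (n : ℕ) :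
    inner 𝕜 (hA.e n) (hA.incl (U.u t)) =
        modeExp k t (hA.μ n) 0 0 • inner 𝕜 (hA.e n) (hA.incl (U.u 0)) +
        modeExp k t (hA.μ n) 0 1 • inner 𝕜 (hA.e n) (U.v 0) +
        ∫ s in (0 : ℝ)..t, modeExp k (t - s) (hA.μ n) 0 1 •
          inner 𝕜 (hA.e n) (-(F (U.u (max s 0)) + M (U.hist s))) ∧
    inner 𝕜 (hA.e n) (U.v t) =
        modeExp k t (hA.μ n) 1 0 • inner 𝕜 (hA.e n) (hA.incl (U.u 0)) +
        modeExp k t (hA.μ n) 1 1 • inner 𝕜 (hA.e n) (U.v 0) +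
        ∫ s in (0 : ℝ)..t, modeExp k (t - s) (hA.μ n) 1 1 •
          inner 𝕜 (hA.e n) (-(F (U.u (max s 0)) + M (U.hist s))) := by
  refine hA.inner_mild hk ht (continuous_forcing hh hF hM hR hU) (U.u 0) (U.v 0)
    (X := (hA.incl (U.u t), U.v t)) ?_ n
  rw [hφ.2 t ht]
  congr 1
  refine intervalIntegral.integral_congr fun s hs => ?_
  rw [uIcc_of_le ht] at hs
  simp only [max_eq_left hs.1]

lemma norm_sub_le_wNorm {U₁ U₂ : hA.Trajectory h} {φ₁ φ₂ : hA.phaseSpace h}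
    (h₁ : U₁.hist 0 = φ₁) (h₂ : U₂.hist 0 = φ₂) {r : ℝ} (hr : r ∈ Icc (-h) 0) :
    ‖U₁.v r - U₂.v r‖ + ‖U₁.u r - U₂.u r‖ ≤ hA.wNorm (φ₁ - φ₂) := by
  subst h₁ h₂
  have h1 := ContinuousMap.norm_coe_le_norm (U₁.hist 0 - U₂.hist 0).1.1 ⟨r, hr⟩
  have h2 := ContinuousMap.norm_coe_le_norm (U₁.hist 0 - U₂.hist 0).1.2 ⟨r, hr⟩
  have h3 : (U₁.hist 0 - U₂.hist 0).1.1 ⟨r, hr⟩ = U₁.u (max 0 0 + r) - U₂.u (max 0 0 + r) := rfl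
  have h4 : (U₁.hist 0 - U₂.hist 0).1.2 ⟨r, hr⟩ = U₁.v (max 0 0 + r) - U₂.v (max 0 0 + r) := rfl
  rw [h3, max_self, zero_add] at h1
  rw [h4, max_self, zero_add] at h2
  unfold wNorm
  linarith

end Forcing

/-! ### The quasi-stability estimate. -/

variable [IsScalarTower ℝ 𝕜 H]

/-- Quasi-stability, when the critical part of `F` is small in comparison with the damping. -/
lemma exists_quasiStable {h : ℝ} (hh : 0 < h) {k ε : ℝ} (hε : 0 < ε) (hk : 4 * ε ≤ k)
    (hμ : 4 * ε ^ 2 ≤ hA.μ 0) {F : hA.Energy → H} (hF : hA.HypF1 F) {M : hA.phaseSpace h → H}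
    (hM : hA.HypM1 M) {R : ℝ} (hR : 0 < R) {δ δM : ℝ≥0} (hδ : δ ≤ 1 / 2) (hδM : δ ≤ δM)
    {L b : ℝ} (hL : 0 < L) (hb : 0 ≤ b)
    (hML : ∀ φ₁ φ₂ : hA.phaseSpace h, hA.wNorm φ₁ ≤ 2 * R → hA.wNorm φ₂ ≤ 2 * R →
      ‖M φ₁ - M φ₂‖ ≤ L * ⨆ θ : Icc (-h) 0, ‖hA.lowPow δM (φ₁.1.1 θ - φ₂.1.1 θ)‖)
    (hFb : ∀ u₁ u₂ : hA.Energy, ‖u₁‖ ≤ R → ‖u₂‖ ≤ R → 16 / k * ‖F u₁ - F u₂‖ ^ 2 ≤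
      ε / 2 * ‖u₁ - u₂‖ ^ 2 + b * ‖hA.lowPow δ (u₁ - u₂)‖ ^ 2) :
    ∃ C₁ C₂ : ℝ, 0 < C₁ ∧ 0 < C₂ ∧ hA.QuasiStable k F M R δ (ε / 2) C₁ C₂ := by
  have hk0 : 0 < k := by linarith
  set c₁ : ℝ := hA.μ 0 ^ (δ - (1 / 2 : ℝ≥0) : ℝ) with hc₁
  set c₂ : ℝ := hA.μ 0 ^ (δ - δM : ℝ) with hc₂
  set c₃ : ℝ := hA.μ 0 ^ (-δM : ℝ) with hc₃
  have hc₁0 : 0 ≤ c₁ := Real.rpow_nonneg hA.μ_pos.le _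
  have hc₂0 : 0 ≤ c₂ := Real.rpow_nonneg hA.μ_pos.le _
  have hc₃0 : 0 ≤ c₃ := Real.rpow_nonneg hA.μ_pos.le _
  -- One constant for all lower-order contributions, used in front of both `B` and `W²`: `b` from
  -- `F`, the factors `32/k` from `M` (two squares of sums), the last term from the damping.
  set K : ℝ := b + 32 / k * L ^ 2 * c₂ ^ 2 + 32 / k * L ^ 2 * c₃ ^ 2 + 8 * ε ^ 2 * k * c₁ ^ 2
    with hK
  have hK0 : 0 ≤ K := by positivity
  refine ⟨4 + K * Real.exp (2 * ε * h) / ε, 2 * K / ε + 1, by positivity, by positivity, ?_⟩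
  intro φ₁ φ₂ U₁ U₂ hU₁ hU₂ hB₁ hB₂ t ht
  set W : ℝ := hA.wNorm (φ₁ - φ₂) with hW
  have hW0 : 0 ≤ W := add_nonneg (norm_nonneg _) (norm_nonneg _)
  set B : ℝ := ⨆ ξ : Icc (0 : ℝ) t, ‖hA.lowPow δ (U₁.u ξ - U₂.u ξ)‖ ^ 2 with hB
  have hB0 : 0 ≤ B := Real.iSup_nonneg fun ξ => by positivity
  -- A real supremum of an unbounded family is `0` by default, so boundedness of the family is drawn
  -- from the bound `R`.
  have hle : ∀ s ∈ Icc 0 t, ‖hA.lowPow δ (U₁.u s - U₂.u s)‖ ^ 2 ≤ B := fun s hs => by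
    refine le_ciSup (f := fun ξ : Icc (0 : ℝ) t => ‖hA.lowPow δ (U₁.u ξ - U₂.u ξ)‖ ^ 2)
      ⟨(hA.μ 0 ^ (-δ : ℝ) * (R + R)) ^ 2, ?_⟩ ⟨s, hs⟩
    rintro _ ⟨ξ, rfl⟩
    have hξ : -h ≤ (ξ : ℝ) := by linarith [ξ.2.1]
    have h1 := Real.rpow_nonneg hA.μ_pos.le (-δ : ℝ)
    have h2 := hA.norm_lowPow_le_norm δ (U₁.u ξ - U₂.u ξ)
    have h3 := norm_sub_le_of_le (hB₁.norm_u_le hR.le hξ) (hB₂.norm_u_le hR.le hξ)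
    have h4 := h2.trans (mul_le_mul_of_nonneg_left h3 h1)
    exact pow_le_pow_left₀ (norm_nonneg _) h4 2
  have hle' : ∀ s ∈ Icc 0 t, ‖hA.lowPow δ (U₁.u s - U₂.u s)‖ ≤ √B := fun s hs =>
    Real.le_sqrt_of_sq_le (hle s hs)
  let z : ℝ → hA.Energy := fun s => U₁.u (max s 0) - U₂.u (max s 0)
  let v : ℝ → H := fun s => U₁.v (max s 0) - U₂.v (max s 0)
  let G : ℝ → H := fun s => -(F (U₁.u (max s 0)) + M (U₁.hist s)) -
    -(F (U₂.u (max s 0)) + M (U₂.hist s))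
  have hz : Continuous z := (U₁.continuous_u hh).sub (U₂.continuous_u hh)
  have hv : Continuous v := (U₁.continuous_v hh).sub (U₂.continuous_v hh)
  have hG₁ := continuous_forcing hh hF hM hR hB₁
  have hG₂ := continuous_forcing hh hF hM hR hB₂
  have hG : Continuous G := hG₁.sub hG₂
  have hz' : Continuous fun s => hA.incl (z s) := hA.continuous_incl.comp hz
  have hmem : ∀ s ∈ Icc 0 t, 8 / k * ‖G s‖ ^ 2 + 8 * ε ^ 2 * k * ‖hA.incl (z s)‖ ^ 2 ≤
      ε / 2 * (‖v s‖ ^ 2 + ‖z s‖ ^ 2) + K * B + K * W ^ 2 * Real.exp (2 * ε * (h - s)) := by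
    intro s hs
    have hs' : -h ≤ s := by linarith [hs.1]
    have hzs : z s = U₁.u s - U₂.u s := by simp only [z, max_eq_left hs.1]
    have hi : ‖hA.incl (z s)‖ ^ 2 ≤ c₁ ^ 2 * B := by
      rw [← norm_lowPow_half, hzs]
      calc ‖hA.lowPow (1 / 2) (U₁.u s - U₂.u s)‖ ^ 2
          ≤ (c₁ * ‖hA.lowPow δ (U₁.u s - U₂.u s)‖) ^ 2 := by
            gcongr
            exact hA.norm_lowPow_le hδ _
        _ = c₁ ^ 2 * ‖hA.lowPow δ (U₁.u s - U₂.u s)‖ ^ 2 := mul_pow _ _ _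
        _ ≤ c₁ ^ 2 * B := by
            gcongr
            exact hle s hs
    have hFs : 16 / k * ‖F (U₁.u s) - F (U₂.u s)‖ ^ 2 ≤ ε / 2 * ‖z s‖ ^ 2 + b * B := by
      rw [hzs]
      refine (hFb _ _ (hB₁.norm_u_le hR.le hs') (hB₂.norm_u_le hR.le hs')).trans ?_
      gcongr
      exact hle s hs
    have hsup : ⨆ θ : Icc (-h) 0, ‖hA.lowPow δM ((U₁.hist s).1.1 θ - (U₂.hist s).1.1 θ)‖ ≤
        c₂ * √B + c₃ * (W * Real.exp (ε * (h - s))) := by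
      have : Nonempty (Icc (-h) 0) := ⟨⟨0, by simp [hh.le]⟩⟩
      refine ciSup_le fun θ => ?_
      have hθ : (U₁.hist s).1.1 θ - (U₂.hist s).1.1 θ = U₁.u (s + θ) - U₂.u (s + θ) := by
        change U₁.u (max s 0 + θ) - U₂.u (max s 0 + θ) = _
        rw [max_eq_left hs.1]
      rw [hθ]
      have hθ1 := θ.2.1
      have hθ2 := θ.2.2
      -- After time `0` the history is seen by `B`. Before it, `s < h`, so `e^{ε(h - s)} ≥ 1` may be
      -- inserted for free: the initial data enter with a decaying weight.
      rcases le_or_gt 0 (s + θ) with hpos | hneg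
      · refine (hA.norm_lowPow_le hδM _).trans (le_add_of_le_of_nonneg ?_ (by positivity))
        exact mul_le_mul_of_nonneg_left (hle' _ ⟨hpos, by linarith [hs.2]⟩) hc₂0
      · refine (hA.norm_lowPow_le_norm δM _).trans (le_add_of_nonneg_of_le (by positivity) ?_)
        refine mul_le_mul_of_nonneg_left ?_ hc₃0
        have h1 := norm_sub_le_wNorm hU₁.1 hU₂.1 (r := s + θ) ⟨by linarith [hs.1], hneg.le⟩
        have h2 : 1 ≤ Real.exp (ε * (h - s)) :=
          Real.one_le_exp (mul_nonneg hε.le (by linarith))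
        have h3 := norm_nonneg (U₁.v (s + θ) - U₂.v (s + θ))
        nlinarith
    have hMs : ‖M (U₁.hist s) - M (U₂.hist s)‖ ^ 2 ≤
        2 * L ^ 2 * (c₂ ^ 2 * B + c₃ ^ 2 * (W ^ 2 * Real.exp (2 * ε * (h - s)))) := by
      have h1 := (hML _ _ (hB₁.wNorm_hist_le hR.le s) (hB₂.wNorm_hist_le hR.le s)).trans
        (mul_le_mul_of_nonneg_left hsup hL.le)
      have h2 : Real.exp (2 * ε * (h - s)) = Real.exp (ε * (h - s)) ^ 2 := by
        rw [← Real.exp_nat_mul]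
        congr 1
        push_cast
        ring
      rw [h2]
      calc ‖M (U₁.hist s) - M (U₂.hist s)‖ ^ 2
          ≤ (L * (c₂ * √B + c₃ * (W * Real.exp (ε * (h - s))))) ^ 2 := by gcongr
        _ ≤ 2 * L ^ 2 * (c₂ ^ 2 * √B ^ 2 + c₃ ^ 2 * (W ^ 2 * Real.exp (ε * (h - s)) ^ 2)) := by
            have := mul_nonneg (sq_nonneg L)
              (sq_nonneg (c₂ * √B - c₃ * (W * Real.exp (ε * (h - s)))))
            linarith
        _ = _ := by rw [Real.sq_sqrt hB0]
    have hGs : ‖G s‖ ^ 2 ≤ 2 * ‖F (U₁.u s) - F (U₂.u s)‖ ^ 2 +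
        2 * ‖M (U₁.hist s) - M (U₂.hist s)‖ ^ 2 := by
      have h1 : G s = -((F (U₁.u s) - F (U₂.u s)) + (M (U₁.hist s) - M (U₂.hist s))) := by
        simp only [G, max_eq_left hs.1]
        abel
      have h2 := norm_add_le (F (U₁.u s) - F (U₂.u s)) (M (U₁.hist s) - M (U₂.hist s))
      rw [h1, norm_neg]
      have h3 := pow_le_pow_left₀ (norm_nonneg _) h2 2
      linarith [sq_nonneg (‖F (U₁.u s) - F (U₂.u s)‖ - ‖M (U₁.hist s) - M (U₂.hist s)‖)]
    set X := W ^ 2 * Real.exp (2 * ε * (h - s)) with hX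
    have hX0 : 0 ≤ X := by positivity
    have e1 := mul_le_mul_of_nonneg_left hGs (by positivity : 0 ≤ 8 / k)
    have e2 := mul_le_mul_of_nonneg_left hMs (by positivity : 0 ≤ 16 / k)
    have e3 := mul_le_mul_of_nonneg_left hi (by positivity : 0 ≤ 8 * ε ^ 2 * k)
    have e4 : 8 / k * (2 * ‖F (U₁.u s) - F (U₂.u s)‖ ^ 2 +
        2 * ‖M (U₁.hist s) - M (U₂.hist s)‖ ^ 2) = 16 / k * ‖F (U₁.u s) - F (U₂.u s)‖ ^ 2 +
        16 / k * ‖M (U₁.hist s) - M (U₂.hist s)‖ ^ 2 := by ring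
    have e5 : 16 / k * (2 * L ^ 2 * (c₂ ^ 2 * B + c₃ ^ 2 * X)) =
        32 / k * L ^ 2 * c₂ ^ 2 * B + 32 / k * L ^ 2 * c₃ ^ 2 * X := by ring
    have e6 : 0 ≤ ε / 2 * ‖v s‖ ^ 2 := by positivity
    have e7 : 0 ≤ 32 / k * L ^ 2 * c₃ ^ 2 * B := by positivity
    have e8 : 0 ≤ b * X := by positivity
    have e9 : 0 ≤ 32 / k * L ^ 2 * c₂ ^ 2 * X := by positivity
    have e10 : 0 ≤ 8 * ε ^ 2 * k * c₁ ^ 2 * X := by positivity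
    rw [mul_assoc K (W ^ 2), ← hX, hK]
    linarith
  have hzv : ∀ t, 0 ≤ t → ∀ n,
      inner 𝕜 (hA.e n) (hA.incl (z t)) =
        modeExp k t (hA.μ n) 0 0 • inner 𝕜 (hA.e n) (hA.incl (z 0)) +
        modeExp k t (hA.μ n) 0 1 • inner 𝕜 (hA.e n) (v 0) +
        ∫ s in (0 : ℝ)..t, modeExp k (t - s) (hA.μ n) 0 1 • inner 𝕜 (hA.e n) (G s) ∧
      inner 𝕜 (hA.e n) (v t) = modeExp k t (hA.μ n) 1 0 • inner 𝕜 (hA.e n) (hA.incl (z 0)) +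
        modeExp k t (hA.μ n) 1 1 • inner 𝕜 (hA.e n) (v 0) +
        ∫ s in (0 : ℝ)..t, modeExp k (t - s) (hA.μ n) 1 1 • inner 𝕜 (hA.e n) (G s) := by
    intro t ht n
    have h1 := hU₁.inner_eq hh hk0.le hF hM hR hB₁ ht n
    have h2 := hU₂.inner_eq hh hk0.le hF hM hR hB₂ ht n
    have hint : ∀ i {g : ℝ → H}, Continuous g → IntervalIntegrable
        (fun s => modeExp k (t - s) (hA.μ n) i 1 • inner 𝕜 (hA.e n) (g s))
        MeasureTheory.volume 0 t := fun i g hg =>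
      (((continuous_modeExp k (hA.μ n) i 1).comp (continuous_const.sub continuous_id)).smul
        (continuous_const.inner hg)).intervalIntegrable _ _
    simp only [z, v, G, max_eq_left ht, max_self, map_sub, inner_sub_right, smul_sub]
    rw [intervalIntegral.integral_sub (hint 0 hG₁) (hint 0 hG₂),
      intervalIntegral.integral_sub (hint 1 hG₁) (hint 1 hG₂), h1.1, h2.1, h1.2, h2.2]
    constructor <;> abel
  have hmain := decay_of_energy_inequality (S := fun s => ‖v s‖ ^ 2 + ‖z s‖ ^ 2)
    (Q := fun s => 8 / k * ‖G s‖ ^ 2 + 8 * ε ^ 2 * k * ‖hA.incl (z s)‖ ^ 2)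
    (S₀ := ‖v 0‖ ^ 2 + ‖z 0‖ ^ 2) (by fun_prop) (by fun_prop) hε hK0 hB0 (sq_nonneg W) ht
    (fun s hs => hA.energy_inequality hε hk hμ hG hz' hzv hs.1) hmem
  have h0 : ‖v 0‖ ^ 2 + ‖z 0‖ ^ 2 ≤ W ^ 2 := by
    have h1 := norm_sub_le_wNorm hU₁.1 hU₂.1 (r := 0) ⟨by linarith, le_rfl⟩
    simp only [v, z, max_self]
    have h2 := norm_nonneg (U₁.v 0 - U₂.v 0)
    have h3 := norm_nonneg (U₁.u 0 - U₂.u 0)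
    have h4 := pow_le_pow_left₀ (add_nonneg h2 h3) h1 2
    linarith [mul_nonneg h2 h3]
  have hexp := Real.exp_pos (-(ε / 2) * t)
  have h1 := mul_le_mul_of_nonneg_right h0 hexp.le
  simp only [z, v, max_eq_left ht] at hmain h1
  refine hmain.trans ?_
  have h2 : (4 + K * Real.exp (2 * ε * h) / ε) * Real.exp (-(ε / 2) * t) * W ^ 2 =
    4 * (W ^ 2 * Real.exp (-(ε / 2) * t)) +
      K * W ^ 2 * Real.exp (2 * ε * h) / ε * Real.exp (-(ε / 2) * t) := by ring
  rw [h2]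
  linarith

end DelayWave.PositiveDiscrete

/-! ### Choice of the constants. -/

theorem theorem4p1 {𝕜 H : Type*} [RCLike 𝕜] [NormedAddCommGroup H] [InnerProductSpace 𝕜 H]
    [CompleteSpace H] [NormedSpace ℝ H] [IsScalarTower ℝ 𝕜 H]
    (A : H →ₗ.[𝕜] H) (hA : DelayWave.PositiveDiscrete A) (h : ℝ) (hh : 0 < h)
    (F : hA.Energy → H) (hF1 : hA.HypF1 F) (hF2 : hA.HypF2 F)
    (M : hA.phaseSpace h → H) (hM1 : hA.HypM1 M) (hM2 : hA.HypM2 M) (hM4 : hA.HypM4 M) :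
    (hA.Subcritical F →
      ∃ δ : ℝ≥0, 0 < δ ∧ ∀ k : ℝ, 0 < k → ∃ lam : ℝ, 0 < lam ∧ ∀ R : ℝ, 0 < R →
        ∃ C₁ C₂ : ℝ, 0 < C₁ ∧ 0 < C₂ ∧ hA.QuasiStable k F M R δ lam C₁ C₂) ∧
    (hA.Critical F →
      ∃ δ : ℝ≥0, 0 < δ ∧ ∃ lam : ℝ, 0 < lam ∧ ∀ R : ℝ, 0 < R →
        ∃ k₀ : ℝ, 0 < k₀ ∧ ∀ k : ℝ, k₀ ≤ k →
          ∃ C₁ C₂ : ℝ, 0 < C₁ ∧ 0 < C₂ ∧ hA.QuasiStable k F M R δ lam C₁ C₂) := by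
  obtain ⟨δM, hδM, hM⟩ := hM4
  have hμ := hA.μ_pos
  have hsq := Real.sq_sqrt hμ.le
  have hsqrt := Real.sqrt_pos.2 hμ
  constructor
  · rintro ⟨η, hη, hF⟩
    refine ⟨min η (min δM (1 / 2)), by positivity, fun k hk => ?_⟩
    -- The largest `ε` allowed by `4ε ≤ k` and `4ε² ≤ μ₀`; it does not involve `R`.
    set ε := min (k / 4) (√(hA.μ 0) / 2) with hε_def
    have hε : 0 < ε := by positivity
    have hε₁ : ε ≤ k / 4 := min_le_left _ _
    have hε₂ : ε ≤ √(hA.μ 0) / 2 := min_le_right _ _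
    refine ⟨ε / 2, by positivity, fun R hR => ?_⟩
    -- The radius is `2R` because `wNorm` adds two maxima, each at most `R`.
    obtain ⟨L, hL, hML⟩ := hM (2 * R) (by positivity)
    obtain ⟨LF, hLF, hFL⟩ := hF R hR
    set δ := min η (min δM (1 / 2)) with hδ
    refine DelayWave.PositiveDiscrete.exists_quasiStable hh hε (by linarith) (by nlinarith) hF1 hM1 hR
      ((min_le_right _ _).trans (min_le_right _ _)) ((min_le_right _ _).trans (min_le_left _ _)) hL
      (b := 16 / k * (LF * hA.μ 0 ^ (δ - η : ℝ)) ^ 2) (by positivity) hML fun u₁ u₂ h₁ h₂ => ?_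
    have h3 : ‖F u₁ - F u₂‖ ≤ LF * hA.μ 0 ^ (δ - η : ℝ) * ‖hA.lowPow δ (u₁ - u₂)‖ := by
      rw [mul_assoc]
      exact (hFL u₁ u₂ h₁ h₂).trans
        (mul_le_mul_of_nonneg_left (hA.norm_lowPow_le (min_le_left _ _) _) hLF.le)
    refine le_add_of_nonneg_of_le (by positivity) ?_
    rw [mul_assoc, ← mul_pow]
    gcongr
  · intro hF
    set ε := √(hA.μ 0) / 2 with hε_def
    have hε : 0 < ε := by positivity
    refine ⟨min δM (1 / 2), by positivity, ε / 2, by positivity, fun R hR => ?_⟩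
    obtain ⟨L, hL, hML⟩ := hM (2 * R) (by positivity)
    obtain ⟨LF, hLF, hFL⟩ := hF R hR
    -- The first summand secures `4ε ≤ k`, the second `16/k · LF² ≤ ε/2`. As `ε` depends on `μ₀`
    -- alone, the decay rate is independent of `R` and `k`.
    refine ⟨4 * ε + 32 * LF ^ 2 / ε, by positivity, fun k hk => ?_⟩
    have h1 : 0 < 32 * LF ^ 2 / ε := by positivity
    have hk0 : 0 < k := by linarith
    refine DelayWave.PositiveDiscrete.exists_quasiStable hh hε (by linarith) (by rw [hε_def]; linarith) hF1 hM1 hR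
      (min_le_right _ _) (min_le_left _ _) hL le_rfl hML fun u₁ u₂ h₁ h₂ => ?_
    have h3 := hFL u₁ u₂ h₁ h₂
    rw [hA.norm_lowPow_zero] at h3
    have h4 : 32 * LF ^ 2 / ε ≤ k := by linarith
    rw [div_le_iff₀ hε] at h4
    have h5 : 16 / k * LF ^ 2 ≤ ε / 2 := by
      rw [div_mul_eq_mul_div, div_le_iff₀ hk0]
      linarith
    rw [zero_mul, add_zero]
    calc 16 / k * ‖F u₁ - F u₂‖ ^ 2 ≤ 16 / k * (LF * ‖u₁ - u₂‖) ^ 2 := by gcongr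
      _ = 16 / k * LF ^ 2 * ‖u₁ - u₂‖ ^ 2 := by ring
      _ ≤ ε / 2 * ‖u₁ - u₂‖ ^ 2 := by gcongr
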